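/- Let $q>2$ be a prime power, let $n\in\{-1,0,1\}$ with $q\equiv n\pmod 3$, and let $g=\gcd(3,q-1)$. Let $V$ be a $3$-dimensional vector space over $\mathbb F_{q^3}$. The points and lines of $\mathrm{PG}(2,q^3)$ are the $1$- and $2$-dimensional $\mathbb F_{q^3}$-subspaces of $V$; the $r$-spaces of $\mathrm{PG}(8,q)$ are the $(r+1)$-dimensional $\mathbb F_q$-subspaces of $V$ (points, lines, planes and hyperplanes for $r=0,1,2,7$). Thus each point (line) of $\mathrm{PG}(2,q^3)$ is also a plane ($5$-space) of $\mathrm{PG}(8,q)$. Let $T$ be an $\mathbb F_{q^3}$-semilinear, $\mathbb F_q$-linear bijection of $V$ with $T^3=\mathrm{id}$ that induces a collineation $\phi$ of $\mathrm{PG}(2,q^3)$ of order $3$ fixing pointwise an $\mathbb F_q$-plane (that is, for some $\mathbb F_{q^3}$-basis of $V$, all points having a coordinate vector over $\mathbb F_q$), and let $\sigma$ be the projectivity of $\mathrm{PG}(8,q)$ induced by $T$. "Fixed" means fixed by $\sigma$. A point of $\mathrm{PG}(2,q^3)$ has Type I if it is fixed by $\phi$, and Type II if its orbit under $\phi$ consists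 of three collinear points; a Type I line is a line fixed by $\phi$. The $\mathbb S_{\mathrm I}$-planes, $\mathbb S_{\mathrm{II}}$-planes and $\mathbb H_{\mathrm I}$-$5$-spaces of $\mathrm{PG}(8,q)$ are those given by the Type I points, Type II points and Type I lines. A point $A$ of $\mathrm{PG}(8,q)$ whose images $A,A^\sigma,A^{\sigma^2}$ are distinct and collinear is a $\mathrm I_{:}$-point if it lies in an $\mathbb S_{\mathrm I}$-plane, and a $\mathrm{II}_{:}$-point if it lies in an $\mathbb S_{\mathrm{II}}$-plane. A ptwise-fixed line is a line all of whose points are fixed; a fixed-I-line (fixed-II-line) is a fixed line containing a $\mathrm I_{:}$-point ($\mathrm{II}_{:}$-point). A hwise-fixed-$5$-space is a $5$-space such that every hyperplane containing it is fixed. An h-plane is a fixed plane that is contained in a hwise-fixed-$5$-space and is not fixed pointwise; it is an $\mathrm h_1$-plane if it contains a fixed-I-line, and an $\mathrm h_2$-plane otherwise. 1. If $q\equiv-1\pmod 3$, then there are no h-planes. 2. If $q\not\equiv-1\pmod 3$, then there are two types of h-planes: each h-plane is either an $\mathrm h_1$-plane or an $\mathrm h_2$-plane, and both types occur. (a) Each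 $\mathrm h_1$-plane lies in an $\mathbb H_{\mathrm I}$-$5$-space and contains exactly $q+1+n$ fixed points, $q-n$ $\mathrm I_{:}$-points and $q^2-q$ $\mathrm{II}_{:}$-points; and exactly $1$ ptwise-fixed line, $1$ fixed-I-line and $q-1+n$ fixed-II-lines. There are exactly $g(n+1)(q+1)(q^2+q+1)$ $\mathrm h_1$-planes. (b) Each $\mathrm h_2$-plane contains exactly $q+1+n$ fixed points and $q^2-n$ $\mathrm{II}_{:}$-points; and exactly $1$ ptwise-fixed line and $q+n$ fixed-II-lines. There are exactly $g(n+1)(q^2+n-1)(q^2+q+1)$ $\mathrm h_2$-planes. -/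

import Mathlib

/-! Setting: `K` is the field with `q` elements, `L` its cubic extension and `V` a
three-dimensional vector space over `L`, so nine-dimensional over `K`.  A point (line) of
`PG(2, q^3)` is an `L`-subspace of `V` of dimension 1 (2); an `r`-space of `PG(8, q)` is a
`K`-subspace of `V` of dimension `r + 1`.  Restriction of scalars sends points of `PG(2, q^3)`
to the planes of a regular 2-spread of `PG(8, q)`. -/

namespace Bose

/-- A semilinear bijection of the `L`-space `V` whose companion automorphism fixes `K`
elementwise; in particular it is a `K`-linear bijection. -/
structure SemilinearAut (K L V : Type*) [Field K] [Field L] [Algebra K L]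
    [AddCommGroup V] [Module K V] [Module L V] where
  /-- the companion field automorphism -/
  companion : L ≃ₐ[K] L
  /-- the underlying `K`-linear bijection -/
  toEquiv : V ≃ₗ[K] V
  map_smul : ∀ (c : L) (v : V), toEquiv (c • v) = companion c • toEquiv v

section

variable {K L V : Type*} [Field K] [Field L] [Algebra K L] [AddCommGroup V] [Module K V]
  [Module L V]

/-- The collineation `φ` of `PG(2, q^3)` induced by `T`, acting on all subspaces: the image. -/
def phi (T : SemilinearAut K L V) (P : Submodule L V) : Submodule L V where
  carrier := T.toEquiv '' (P : Set V)
  add_mem' := by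
    rintro _ _ ⟨a, ha, rfl⟩ ⟨b, hb, rfl⟩
    exact ⟨a + b, P.add_mem ha hb, map_add _ _ _⟩
  zero_mem' := ⟨0, P.zero_mem, map_zero _⟩
  smul_mem' := by
    rintro c _ ⟨a, ha, rfl⟩
    refine ⟨T.companion.symm c • a, P.smul_mem _ ha, ?_⟩
    rw [T.map_smul, AlgEquiv.apply_symm_apply]

/-- The projectivity `σ` of `PG(8, q)` induced by `T`, acting on all subspaces: the image. -/
def sigma (T : SemilinearAut K L V) (W : Submodule K V) : Submodule K V :=
  W.map (T.toEquiv : V →ₗ[K] V)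

/-- `φ` has order 3 as a permutation of the points of `PG(2, q^3)`. -/
def PhiOrderThree (T : SemilinearAut K L V) : Prop :=
  (∀ P : Submodule L V, Module.finrank L P = 1 → phi T (phi T (phi T P)) = P) ∧
    ∃ P : Submodule L V, Module.finrank L P = 1 ∧ phi T P ≠ P

variable (K) in
/-- `B` is (the point set of) an `𝔽_q`-plane of `PG(2, q^3)`: the points with a coordinate vector
over `K` with respect to some `L`-basis of `V`. -/
def IsSubplane (B : Set (Submodule L V)) : Prop :=
  ∃ b : Module.Basis (Fin 3) L V,
    B = {P | ∃ v ∈ Submodule.span K (Set.range b), v ≠ 0 ∧ P = Submodule.span L {v}}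

/-! ### Types of points and lines of `PG(2, q^3)` -/

/-- Type I points: those fixed by `φ`. -/
def TypeIPoint (T : SemilinearAut K L V) (P : Submodule L V) : Prop :=
  Module.finrank L P = 1 ∧ phi T P = P

/-- Type II points: those whose orbit under `φ` is three collinear points. -/
def TypeIIPoint (T : SemilinearAut K L V) (P : Submodule L V) : Prop :=
  Module.finrank L P = 1 ∧
    P ≠ phi T P ∧ phi T P ≠ phi T (phi T P) ∧ P ≠ phi T (phi T P) ∧
    Module.finrank L (P ⊔ phi T P ⊔ phi T (phi T P) : Submodule L V) = 2

/-- Type I lines: those fixed by `φ`. -/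
def TypeILine (T : SemilinearAut K L V) (l : Submodule L V) : Prop :=
  Module.finrank L l = 2 ∧ phi T l = l

/-! ### Spread planes, 5-spaces and points of `PG(8, q)` -/

section

variable [IsScalarTower K L V]

/-- `𝕊_I`-planes. -/
def IsSIPlane (T : SemilinearAut K L V) (α : Submodule K V) : Prop :=
  ∃ P : Submodule L V, TypeIPoint T P ∧ α = P.restrictScalars K

/-- `𝕊_II`-planes. -/
def IsSIIPlane (T : SemilinearAut K L V) (α : Submodule K V) : Prop :=
  ∃ P : Submodule L V, TypeIIPoint T P ∧ α = P.restrictScalars K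

/-- `ℍ_I`-5-spaces. -/
def IsHI5Space (T : SemilinearAut K L V) (S : Submodule K V) : Prop :=
  ∃ l : Submodule L V, TypeILine T l ∧ S = l.restrictScalars K

end

/-- Points of `PG(8, q)` fixed by `σ`. -/
def IsFixedPoint (T : SemilinearAut K L V) (A : Submodule K V) : Prop :=
  Module.finrank K A = 1 ∧ sigma T A = A

/-- `A` is a point of `PG(8, q)` such that `A`, `A^σ`, `A^(σ^2)` are distinct and collinear. -/
def CollinearOrbit (T : SemilinearAut K L V) (A : Submodule K V) : Prop :=
  Module.finrank K A = 1 ∧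
    A ≠ sigma T A ∧ sigma T A ≠ sigma T (sigma T A) ∧ A ≠ sigma T (sigma T A) ∧
    Module.finrank K (A ⊔ sigma T A ⊔ sigma T (sigma T A) : Submodule K V) = 2

section

variable [IsScalarTower K L V]

/-- `I_:`-points: points of an `𝕊_I`-plane with three distinct collinear images. -/
def IsIColPoint (T : SemilinearAut K L V) (A : Submodule K V) : Prop :=
  CollinearOrbit T A ∧ ∃ α, IsSIPlane T α ∧ A ≤ α

/-- `II_:`-points: points of an `𝕊_II`-plane with three (distinct) collinear images. -/
def IsIIColPoint (T : SemilinearAut K L V) (A : Submodule K V) : Prop :=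
  CollinearOrbit T A ∧ ∃ α, IsSIIPlane T α ∧ A ≤ α

end

/-! ### Fixed lines and h-planes -/

/-- Every point of `W` is fixed by `σ`. -/
def PtwiseFixed (T : SemilinearAut K L V) (W : Submodule K V) : Prop :=
  ∀ A : Submodule K V, Module.finrank K A = 1 → A ≤ W → sigma T A = A

/-- Ptwise-fixed lines. -/
def IsPtwiseFixedLine (T : SemilinearAut K L V) (l : Submodule K V) : Prop :=
  Module.finrank K l = 2 ∧ PtwiseFixed T l

section

variable [IsScalarTower K L V]

/-- Fixed-I-lines: fixed lines, not fixed pointwise, whose non-fixed points are `I_:`-points;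
equivalently fixed lines that contain an `I_:`-point. -/
def IsFixedILine (T : SemilinearAut K L V) (l : Submodule K V) : Prop :=
  Module.finrank K l = 2 ∧ sigma T l = l ∧ ∃ A ≤ l, IsIColPoint T A

/-- Fixed-II-lines: fixed lines, not fixed pointwise, whose non-fixed points are `II_:`-points;
equivalently fixed lines that contain a `II_:`-point. -/
def IsFixedIILine (T : SemilinearAut K L V) (l : Submodule K V) : Prop :=
  Module.finrank K l = 2 ∧ sigma T l = l ∧ ∃ A ≤ l, IsIIColPoint T A

end

/-- Hwise-fixed-5-spaces: all hyperplanes of `PG(8, q)` through the 5-space are fixed by `σ`. -/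
def IsHwiseFixed5Space (T : SemilinearAut K L V) (W : Submodule K V) : Prop :=
  Module.finrank K W = 6 ∧
    ∀ H : Submodule K V, Module.finrank K H = 8 → W ≤ H → sigma T H = H

/-- h-planes: fixed planes that lie in a hwise-fixed-5-space and are not fixed pointwise. -/
def IsHPlane (T : SemilinearAut K L V) (π : Submodule K V) : Prop :=
  Module.finrank K π = 3 ∧ sigma T π = π ∧ ¬ PtwiseFixed T π ∧
    ∃ W, IsHwiseFixed5Space T W ∧ π ≤ W

section

variable [IsScalarTower K L V]

/-- `h₁`-planes: the h-planes that contain a fixed-I-line. -/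
def IsH1Plane (T : SemilinearAut K L V) (π : Submodule K V) : Prop :=
  IsHPlane T π ∧ ∃ l ≤ π, IsFixedILine T l

/-- `h₂`-planes: the h-planes that contain no fixed-I-line. -/
def IsH2Plane (T : SemilinearAut K L V) (π : Submodule K V) : Prop :=
  IsHPlane T π ∧ ¬ ∃ l ≤ π, IsFixedILine T l

end

end

end Bose

/-! The proof is linear algebra over `K` for the map `T` with `T³ = 1`; let `θ` be its companion
automorphism. A basis of the fixed subplane consists of `L`-eigenvectors with one common eigenvalue
of norm 1, so Hilbert 90 rescales it to a `K`-basis of `eig T a` for each cube root of unity `a ∈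
K`, and all these eigenspaces have dimension 3 (`isRegular`). By duality the hwise-fixed-5-spaces
are the ranges of `T - c` with `c³ = 1` (`isHwiseFixed5Space_iff`), so an h-plane is annihilated by
`T² + cT + c²`.

If `q ≡ -1`, then `c = 1` and `T` fixes no nonzero vector of such a plane; orbits of length 3 give
`q³ ≡ 1 (mod 3)`, which is absurd. Otherwise `T² + cT + c² = (T - a)(T - b)`, and rank-nullity
produces, up to swapping `a` and `b`, a line `ℓ` of `a`-eigenvectors with `(T - b)π ⊆ ℓ`
(`IsFrame`). The plane determines `(a, b, ℓ)`, and every frame plane is an h-plane. There are 6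
pairs `(a, b)`, all with `a ≠ b`, if `q ≡ 1`, and only `(1, 1)` if `3 ∣ q`: in both cases `g(n + 1)`
pairs, with `eps a b = n`. Each `eig T a` contains `q² + q + 1` lines `ℓ`.

To count the planes on `ℓ`, take `λ ∈ L \ K` with `aθ(λ) = bλ + 1` (`IsShift`). Then the kernel of
`(T - a)(T - b)` is `eig T a ⊕ λ eig T a`, and the non-fixed type I points of `π` are those on a
line `⟨z, λz⟩ ⊆ π` with `z ∈ ℓ`. Hence the h₁-planes on `ℓ` are the `q + 1` planes `ℓ + ⟨λz⟩`, and
the h₂-planes are generated by a normalised vector `x + λy` depending on a parameter in `ℓ`, which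
leaves `q² + n - 1`. Inside any frame plane there are `q² - n` non-fixed points; each lies on
exactly one fixed line, and each fixed line other than `ℓ` carries `q - n` of them, so there are `q
+ n` such lines. -/

namespace Bose

open Module

/-! ### Counting points and lines of finite projective spaces -/

section Counting

/-- Double counting of incidences. A relation replaces a map `S → T`, so it suffices that the
element attached to each `s` exists uniquely. -/
theorem ncard_eq_mul_of_fibers {α β : Type*} [Finite α] [Finite β] {S : Set α} {T : Set β}
    (r : α → β → Prop) (k : ℕ) (h1 : ∀ s ∈ S, ∃! t, t ∈ T ∧ r s t)
    (h2 : ∀ t ∈ T, {s | s ∈ S ∧ r s t}.ncard = k) : S.ncard = T.ncard * k := by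
  classical
  have := Fintype.ofFinite α
  have := Fintype.ofFinite β
  have key := Finset.card_mul_eq_card_mul (s := S.toFinset) (t := T.toFinset) r (m := 1) (n := k)
    (by
      intro s hs
      obtain ⟨t, ht, hu⟩ := h1 s (by simpa using hs)
      rw [Finset.card_eq_one]
      refine ⟨t, ?_⟩
      ext t'
      simp only [Finset.mem_bipartiteAbove, Set.mem_toFinset, Finset.mem_singleton]
      exact ⟨fun h => hu t' h, fun h => h ▸ ht⟩)
    (by
      intro t ht
      rw [← h2 t (by simpa using ht), ← Set.ncard_coe_finset]
      congr 1
      ext s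
      simp)
  simpa [Set.ncard_eq_toFinset_card'] using key

variable {K V : Type*} [Field K] [AddCommGroup V] [Module K V]

theorem finrank_eq_one_iff_exists_span {A : Submodule K V} :
    finrank K A = 1 ↔ ∃ v, v ≠ 0 ∧ A = K ∙ v := by
  constructor
  · intro h
    obtain ⟨⟨v, hv⟩, hv0, h⟩ := finrank_eq_one_iff'.1 h
    refine ⟨v, by simpa using hv0, le_antisymm (fun w hw => ?_) ?_⟩
    · obtain ⟨c, hc⟩ := h ⟨w, hw⟩
      exact Submodule.mem_span_singleton.2 ⟨c, congrArg Subtype.val hc⟩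
    · simpa using hv
  · rintro ⟨v, hv, rfl⟩
    exact finrank_span_singleton hv

theorem span_singleton_eq_of_mem {v w : V} (hw : w ≠ 0) (h : w ∈ K ∙ v) : (K ∙ w) = K ∙ v := by
  obtain ⟨c, rfl⟩ := Submodule.mem_span_singleton.1 h
  have hc : c ≠ 0 := by rintro rfl; simp at hw
  exact Submodule.span_singleton_smul_eq (IsUnit.mk0 c hc) v

/-- The points of `E ⊔ ⟨v⟩` outside `E` correspond to the vectors of `E`. -/
theorem ncard_points_compl {E : Submodule K V} {v : V} (hv : v ∉ E) (P : Submodule K V → Prop) :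
    {A : Submodule K V | finrank K A = 1 ∧ A ≤ E ⊔ K ∙ v ∧ ¬ A ≤ E ∧ P A}.ncard
      = {u | u ∈ E ∧ P (K ∙ (v + u))}.ncard := by
  have : {A : Submodule K V | finrank K A = 1 ∧ A ≤ E ⊔ K ∙ v ∧ ¬ A ≤ E ∧ P A}
      = (fun u => K ∙ (v + u)) '' {u | u ∈ E ∧ P (K ∙ (v + u))} := by
    ext A
    constructor
    · rintro ⟨h1, h2, h3, h4⟩
      obtain ⟨w, hw, rfl⟩ := finrank_eq_one_iff_exists_span.1 h1
      rw [Submodule.span_singleton_le_iff_mem] at h2 h3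
      obtain ⟨e, he, y, hy, rfl⟩ := Submodule.mem_sup.1 h2
      obtain ⟨c, rfl⟩ := Submodule.mem_span_singleton.1 hy
      have hc : c ≠ 0 := by rintro rfl; simp [he] at h3
      have hs : (K ∙ (v + c⁻¹ • e)) = K ∙ (e + c • v) := by
        rw [← Submodule.span_singleton_smul_eq (IsUnit.mk0 c hc), smul_add, smul_inv_smul₀ hc,
          add_comm]
      exact ⟨c⁻¹ • e, ⟨E.smul_mem _ he, hs ▸ h4⟩, hs⟩
    · rintro ⟨u, ⟨hu, hP⟩, rfl⟩
      have hn : v + u ∉ E := fun h => hv (by simpa using E.sub_mem h hu)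
      refine ⟨finrank_span_singleton (fun h => hn (h ▸ E.zero_mem)), ?_, ?_, hP⟩
      · rw [Submodule.span_singleton_le_iff_mem, add_comm]
        exact Submodule.add_mem_sup hu (Submodule.mem_span_singleton_self v)
      · rwa [Submodule.span_singleton_le_iff_mem]
  rw [this]
  refine Set.InjOn.ncard_image ?_
  rintro u ⟨hu, -⟩ u' ⟨hu', -⟩ h
  have : v + u ∈ K ∙ (v + u') := by
    simp only at h
    rw [← h]; exact Submodule.mem_span_singleton_self _
  obtain ⟨c, hc⟩ := Submodule.mem_span_singleton.1 this
  have h1 : (c - 1) • v = u - c • u' := by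
    rw [sub_smul, one_smul, sub_eq_sub_iff_add_eq_add, ← smul_add, hc, add_comm]
  have hc1 : c = 1 := by
    by_contra hne
    have hne : c - 1 ≠ 0 := sub_ne_zero.2 hne
    apply hv
    rw [← inv_smul_smul₀ hne v, h1]
    exact E.smul_mem _ (E.sub_mem hu (E.smul_mem _ hu'))
  subst hc1
  simpa using hc.symm

theorem ncard_submodule_le (U : Submodule K V) (P : Submodule K V → Prop) :
    {A : Submodule K V | P A ∧ A ≤ U}.ncard
      = {A : Submodule K U | P (A.map U.subtype)}.ncard := by
  have : {A : Submodule K V | P A ∧ A ≤ U}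
      = Submodule.map U.subtype '' {A : Submodule K U | P (A.map U.subtype)} := by
    ext A
    constructor
    · rintro ⟨h, hU⟩
      have : Submodule.map U.subtype (A.comap U.subtype) = A := by
        rw [Submodule.map_comap_subtype, inf_eq_right.2 hU]
      exact ⟨A.comap U.subtype, by simpa only [Set.mem_ofPred_eq, this] using h, this⟩
    · rintro ⟨B, hB, rfl⟩
      exact ⟨hB, Submodule.map_subtype_le U B⟩
  rw [this, Set.ncard_image_of_injective _
    (Submodule.map_injective_of_injective U.injective_subtype)]

theorem finrank_map_subtype (U : Submodule K V) (A : Submodule K U) :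
    finrank K (A.map U.subtype) = finrank K A :=
  LinearEquiv.finrank_eq (Submodule.equivMapOfInjective _ U.injective_subtype A).symm

theorem ncard_points [Finite K] {d : ℕ} (hd : finrank K V = d) :
    {A : Submodule K V | finrank K A = 1}.ncard = ∑ i ∈ Finset.range d, Nat.card K ^ i := by
  rw [← Projectivization.card_of_finrank K V hd]
  exact Nat.card_congr (Projectivization.equivSubmodule K V).symm

theorem ncard_points_le [Finite K] {U : Submodule K V} {d : ℕ} (hd : finrank K U = d) :
    {A : Submodule K V | finrank K A = 1 ∧ A ≤ U}.ncard
      = ∑ i ∈ Finset.range d, Nat.card K ^ i := by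
  rw [ncard_submodule_le U (fun A => finrank K A = 1), ← ncard_points hd]
  simp only [finrank_map_subtype]

/-- Annihilators turn lines of a projective plane into points of the dual plane. -/
theorem ncard_lines_le [Finite K] {U : Submodule K V} (hU : finrank K U = 3) :
    {A : Submodule K V | finrank K A = 2 ∧ A ≤ U}.ncard
      = ∑ i ∈ Finset.range 3, Nat.card K ^ i := by
  have : FiniteDimensional K U := FiniteDimensional.of_finrank_pos (by omega)
  rw [ncard_submodule_le U (fun A => finrank K A = 2),
    ← ncard_points (K := K) (V := Dual K U) (by rw [Subspace.dual_finrank_eq, hU])]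
  simp only [finrank_map_subtype]
  refine Set.ncard_congr (fun A _ => A.dualAnnihilator) ?_ ?_ ?_
  · intro A hA
    have := Subspace.finrank_add_finrank_dualAnnihilator_eq A
    simp only [Set.mem_ofPred_eq] at hA ⊢
    omega
  · intro A B _ _ h
    exact Subspace.dualAnnihilator_inj.1 h
  · intro B hB
    have := Subspace.finrank_add_finrank_dualCoannihilator_eq B
    simp only [Set.mem_ofPred_eq] at hB
    exact ⟨B.dualCoannihilator, by simp only [Set.mem_ofPred_eq]; omega,
      Subspace.dualCoannihilator_dualAnnihilator_eq⟩

theorem exists_forall_smul_of_forall_mem_span (f : V →ₗ[K] V)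
    (h : ∀ v, f v ∈ K ∙ v) : ∃ c : K, ∀ v, f v = c • v := by
  obtain ⟨c, hc⟩ := f.exists_eq_smul_id_of_forall_notLinearIndependent fun v hv => by
    obtain ⟨c, hc⟩ := Submodule.mem_span_singleton.1 (h v)
    have := LinearIndependent.pair_iff.1 hv c (-1) (by simp [hc])
    simp at this
  exact ⟨c, fun v => by simp [hc]⟩

theorem finrank_sup_span_singleton {E : Submodule K V} {v : V} (hv : v ∉ E) (d : ℕ)
    [FiniteDimensional K V] (hd : finrank K E = d) : finrank K (E ⊔ K ∙ v : Submodule K V) = d + 1 := by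
  have h1 := Submodule.finrank_sup_add_finrank_inf_eq E (K ∙ v)
  have h2 : E ⊓ K ∙ v = ⊥ := by
    rw [← disjoint_iff, Submodule.disjoint_span_singleton]
    intro h; exact absurd h hv
  rw [h2, finrank_bot, finrank_span_singleton (ne_of_mem_of_not_mem E.zero_mem hv).symm] at h1
  omega

end Counting

/-- For a semilinear map of order three, a vector that is not an eigenvector and whose third
image depends on the first two has three distinct collinear images. -/
theorem collinear_orbit {F V : Type*} [Field F] [AddCommGroup V] [Module F V] (τ : F ≃+* F)
    (S : V → V) (hsmul : ∀ (c : F) v, S (c • v) = τ c • S v) (hS : ∀ v, S (S (S v)) = v)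
    {w : V} (h0 : w ≠ 0) (h1 : S w ∉ F ∙ w) (h2 : S (S w) ∈ Submodule.span F {w, S w}) :
    (F ∙ w) ≠ (F ∙ S w) ∧ (F ∙ S w) ≠ (F ∙ S (S w)) ∧ (F ∙ w) ≠ (F ∙ S (S w)) ∧
      finrank F ((F ∙ w) ⊔ (F ∙ S w) ⊔ (F ∙ S (S w)) : Submodule F V) = 2 := by
  have aux : S (S w) ∉ F ∙ S w := by
    intro h
    obtain ⟨c, hc⟩ := Submodule.mem_span_singleton.1 h
    apply h1
    -- Since `S` is invertible with inverse `S²`, the relation `S(Sw) = c · Sw` pulls back to `Sw =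
    -- τ⁻¹(c) · w`.
    refine Submodule.mem_span_singleton.2 ⟨τ.symm c, ?_⟩
    have := congrArg (fun v => S (S v)) hc
    simp only [hsmul, hS] at this
    have h3 := congrArg (fun v => S (S v)) (show S (τ.symm c • w) = S (S w) by simp [hsmul, hc])
    simpa only [hS] using h3
  refine ⟨fun h => h1 (h ▸ Submodule.mem_span_singleton_self _),
    fun h => aux (h ▸ Submodule.mem_span_singleton_self _), fun h => h1 ?_, ?_⟩
  · have h3 : S (S w) ∈ F ∙ w := h ▸ Submodule.mem_span_singleton_self _
    have h4 : w ∈ F ∙ S (S w) := h ▸ Submodule.mem_span_singleton_self _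
    obtain ⟨c, hc⟩ := Submodule.mem_span_singleton.1 h4
    have := congrArg S hc
    simp only [hsmul, hS] at this
    exact Submodule.mem_span_singleton.2 ⟨_, this⟩
  · have : (F ∙ w) ⊔ (F ∙ S w) ⊔ (F ∙ S (S w)) = Submodule.span F (Set.range ![w, S w]) := by
      rw [Matrix.range_cons_cons_empty, ← Submodule.span_insert]
      exact sup_eq_left.2 ((Submodule.span_singleton_le_iff_mem _ _).2 h2)
    rw [this, finrank_span_eq_card, Fintype.card_fin]
    rw [LinearIndependent.pair_iff' h0]
    intro a ha
    exact h1 (Submodule.mem_span_singleton.2 ⟨a, ha⟩)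

/-! ### Eigenspaces of `T` and the shift scalar `λ` -/

section

variable {K L V : Type*} [Field K] [Field L] [Algebra K L] [AddCommGroup V] [Module K V]
  [Module L V]

/-- The eigenspace of `T`, as a `K`-linear map, for `a`. -/
def eig (T : SemilinearAut K L V) (a : K) : Submodule K V :=
  Module.End.eigenspace (T.toEquiv : V →ₗ[K] V) a

theorem mem_eig {T : SemilinearAut K L V} {a : K} {v : V} :
    v ∈ eig T a ↔ T.toEquiv v = a • v := by
  simp [eig]

/-- The properties of `T` that follow from fixing an `𝔽_q`-plane pointwise. -/
structure IsRegular (T : SemilinearAut K L V) : Prop where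
  cube : ∀ v, T.toEquiv (T.toEquiv (T.toEquiv v)) = v
  companion_cube : ∀ x, T.companion (T.companion (T.companion x)) = x
  exists_of_fixed : ∀ x, T.companion x = x → ∃ k : K, algebraMap K L k = x
  finrank_field : finrank K L = 3
  finrank_space : finrank K V = 9
  finrank_eig : ∀ a : K, a ^ 3 = 1 → finrank K (eig T a) = 3

/-- Pairs `(a, b)` with `X ^ 3 - 1 = (X - a) (X - b) (X + a + b)`. -/
def GoodPair (a b : K) : Prop := a ^ 3 = 1 ∧ a ^ 2 + a * b + b ^ 2 = 0

theorem GoodPair.ne_zero {a b : K} (h : GoodPair a b) : a ≠ 0 := by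
  rintro rfl
  simpa using h.1

theorem GoodPair.symm {a b : K} (h : GoodPair a b) : GoodPair b a :=
  ⟨by linear_combination h.1 - (a - b) * h.2, by linear_combination h.2⟩

theorem GoodPair.third {a b : K} (h : GoodPair a b) : (-(a + b)) ^ 3 = 1 := by
  linear_combination h.1 - (2 * a + b) * h.2

/-- `lam` is a scalar for which `lam • eig T a` complements `eig T a` in the sum of the
generalized eigenspaces for `a` and `b`. -/
def IsShift (T : SemilinearAut K L V) (a b : K) (lam : L) : Prop :=
  (∀ k : K, algebraMap K L k ≠ lam) ∧
    algebraMap K L a * T.companion lam = algebraMap K L b * lam + 1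

theorem exists_isShift {T : SemilinearAut K L V} (hT : IsRegular T) {a b : K}
    (h : GoodPair a b) : ∃ lam, IsShift T a b lam := by
  have ha := h.ne_zero
  have haL : algebraMap K L a ≠ 0 := by simpa using ha
  have hL : (algebraMap K L a) ^ 2 + algebraMap K L a * algebraMap K L b
      + (algebraMap K L b) ^ 2 = 0 := by
    rw [← map_pow, ← map_pow, ← map_mul, ← map_add, ← map_add, h.2, map_zero]
  -- Since `a² + ab + b² = 0`, one has `(aX - b)(aX + a + b) = a²(X² + X + 1)`. Thus `(aθ - b) ∘ g`
  -- is `a²` times the trace and takes values in `K`.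
  let g : L →ₗ[K] L := a • T.companion.toLinearMap + (a + b) • LinearMap.id
  have hg : ∀ x, g x = algebraMap K L a * T.companion x
      + (algebraMap K L a + algebraMap K L b) * x := by
    intro x
    simp [g, Algebra.smul_def, add_mul]
  have hfix : ∀ x, ∃ k : K, algebraMap K L k
      = algebraMap K L a * T.companion (g x) - algebraMap K L b * g x := by
    intro x
    apply hT.exists_of_fixed
    simp only [hg, map_add, map_sub, map_mul, AlgEquiv.commutes, hT.companion_cube]
    linear_combination hL * (x - T.companion x)
  -- If `g` mapped into `K`, its rank would be at most 1; its kernel also has dimension at most 1,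
  -- because the ratio of two solutions is fixed by `θ`. But `L` has dimension 3.
  obtain ⟨x, hx⟩ : ∃ x, ∀ k : K, algebraMap K L k ≠ g x := by
    by_contra! hcon
    have : FiniteDimensional K L := FiniteDimensional.of_finrank_pos (by rw [hT.finrank_field]; simp)
    have h1 := g.finrank_range_add_finrank_ker
    have h2 : finrank K (LinearMap.range g) ≤ 1 := by
      refine (Submodule.finrank_mono (t := K ∙ (1 : L)) ?_).trans (finrank_span_singleton one_ne_zero).le
      rintro _ ⟨x, rfl⟩
      obtain ⟨k, hk⟩ := hcon x
      exact Submodule.mem_span_singleton.2 ⟨k, by rw [← hk, Algebra.algebraMap_eq_smul_one]⟩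
    have h3 : finrank K (LinearMap.ker g) ≤ 1 := by
      by_cases hb : ∃ y, y ∈ LinearMap.ker g ∧ y ≠ 0
      · obtain ⟨y, hy, hy0⟩ := hb
        refine finrank_le_one ⟨y, hy⟩ ?_
        rintro ⟨z, hz⟩
        rw [LinearMap.mem_ker, hg] at hy hz
        have hty : T.companion y ≠ 0 := by simpa using hy0
        obtain ⟨k, hk⟩ := hT.exists_of_fixed (z / y) (by
          rw [map_div₀, div_eq_div_iff hty hy0]
          apply mul_left_cancel₀ haL
          linear_combination y * hz - z * hy)
        refine ⟨k, Subtype.ext ?_⟩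
        simp [Algebra.smul_def, hk, div_mul_cancel₀ z hy0]
      · push Not at hb
        have : LinearMap.ker g = ⊥ := (Submodule.eq_bot_iff _).2 hb
        rw [this, finrank_bot]; exact zero_le_one
    rw [hT.finrank_field] at h1
    omega
  obtain ⟨κ, hκ⟩ := hfix x
  by_cases h0 : κ = 0
  · subst h0
    -- Here `g x` solves the homogeneous equation, and the constant `1 / (a - b)` is a particular
    -- solution of the inhomogeneous one.
    have hab : a - b ≠ 0 := by
      intro hab
      have hab := sub_eq_zero.1 hab
      subst hab
      obtain ⟨k, hk⟩ := hT.exists_of_fixed (g x) (by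
        apply mul_left_cancel₀ haL
        rw [map_zero] at hκ
        linear_combination -hκ)
      exact hx k hk
    have habL : algebraMap K L a - algebraMap K L b ≠ 0 := by
      rwa [← map_sub, Ne, map_eq_zero]
    refine ⟨g x + algebraMap K L (a - b)⁻¹, fun k hk => hx (k - (a - b)⁻¹) ?_, ?_⟩
    · rw [map_sub, hk]; ring
    · rw [map_zero] at hκ
      rw [map_add, AlgEquiv.commutes, map_inv₀, map_sub]
      field_simp
      linear_combination -(algebraMap K L a - algebraMap K L b) * hκ
  · have hκL : algebraMap K L κ ≠ 0 := by simpa using h0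
    refine ⟨algebraMap K L κ⁻¹ * g x, fun k hk => hx (κ * k) ?_, ?_⟩
    · rw [map_mul, hk, map_inv₀, mul_inv_cancel_left₀ hκL]
    · rw [map_mul, AlgEquiv.commutes, map_inv₀]
      field_simp
      linear_combination -hκ

/-- The scalar `ρ = (b - a)λ + 1` satisfies `aθ(ρ) = bρ`, so it carries `eig T a` into `eig T b`,
and `(T - a)(λy) = ρy` for `y ∈ eig T a`. Its vanishing would put `λ` in `K`. -/
theorem IsShift.rho_ne_zero {T : SemilinearAut K L V} {a b : K} {lam : L}
    (hl : IsShift T a b lam) :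
    (algebraMap K L b - algebraMap K L a) * lam + 1 ≠ 0 := by
  intro h
  by_cases hab : b - a = 0
  · rw [← map_sub, hab] at h
    simp at h
  · have habL : algebraMap K L b - algebraMap K L a ≠ 0 := by
      rwa [← map_sub, Ne, map_eq_zero]
    apply hl.1 (-(b - a)⁻¹)
    rw [map_neg, map_inv₀, map_sub]
    field_simp
    linear_combination -h

/-- Solutions of the inhomogeneous equation lie in the `K`-span of `1` and `lam`. -/
theorem IsShift.exists_eq {T : SemilinearAut K L V} (hT : IsRegular T) {a b : K} {lam : L}
    (h : GoodPair a b) (hl : IsShift T a b lam) {nu : L}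
    (hn : algebraMap K L a * T.companion nu = algebraMap K L b * nu + 1) :
    ∃ α β : K, nu = algebraMap K L α + algebraMap K L β * lam := by
  have haL : algebraMap K L a ≠ 0 := by simpa using h.ne_zero
  have hr := hl.rho_ne_zero
  set ρ := (algebraMap K L b - algebraMap K L a) * lam + 1 with hρ
  have e1 : algebraMap K L a * T.companion ρ = algebraMap K L b * ρ := by
    simp only [hρ, map_add, map_mul, map_sub, AlgEquiv.commutes, map_one]
    linear_combination (algebraMap K L b - algebraMap K L a) * hl.2
  have hr' : T.companion ρ ≠ 0 := by simpa using hr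
  -- `(b - a)ν + 1` and `ρ` solve the same homogeneous equation `aθ(x) = bx`, so their ratio is
  -- fixed by `θ`.
  obtain ⟨β, hβ⟩ := hT.exists_of_fixed
    (((algebraMap K L b - algebraMap K L a) * nu + 1) / ρ) (by
      rw [map_div₀, div_eq_div_iff hr' hr]
      simp only [map_add, map_mul, map_sub, AlgEquiv.commutes, map_one]
      apply mul_left_cancel₀ haL
      linear_combination ((algebraMap K L b - algebraMap K L a) * nu + 1) * (-e1)
        + ρ * (algebraMap K L b - algebraMap K L a) * hn)
  rw [eq_div_iff hr, hρ] at hβ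
  obtain ⟨α, hα⟩ := hT.exists_of_fixed (nu - algebraMap K L β * lam) (by
    apply mul_left_cancel₀ haL
    simp only [map_mul, map_sub, AlgEquiv.commutes]
    linear_combination hn - algebraMap K L β * hl.2 - hβ)
  exact ⟨α, β, by rw [hα]; ring⟩

theorem map_smul_eig {T : SemilinearAut K L V} {a : K} {x : V} (hx : x ∈ eig T a) (c : L) :
    T.toEquiv (c • x) = T.companion c • a • x := by
  rw [T.map_smul, mem_eig.1 hx]

variable [IsScalarTower K L V]

theorem exists_of_smul_mem_eig {T : SemilinearAut K L V} (hT : IsRegular T) {a : K} (ha : a ≠ 0)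
    {x : V} (hx : x ∈ eig T a) (hx0 : x ≠ 0) {c : L} (hc : c • x ∈ eig T a) :
    ∃ k : K, algebraMap K L k = c := by
  apply hT.exists_of_fixed
  rw [mem_eig, map_smul_eig hx, smul_comm] at hc
  exact smul_left_injective L hx0 (smul_right_injective V ha hc)

theorem IsShift.eq_zero_of_smul_mem {T : SemilinearAut K L V} (hT : IsRegular T) {a b : K}
    (ha : a ≠ 0) {lam : L} (hl : IsShift T a b lam) {y : V} (hy : y ∈ eig T a)
    (h : lam • y ∈ eig T a) : y = 0 := by
  by_contra hy0
  obtain ⟨k, hk⟩ := exists_of_smul_mem_eig hT ha hy hy0 h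
  exact hl.1 k hk

theorem IsShift.map_smul {T : SemilinearAut K L V} {a b : K} {lam : L} (hl : IsShift T a b lam)
    {y : V} (hy : y ∈ eig T a) : T.toEquiv (lam • y) = b • lam • y + y := by
  rw [map_smul_eig hy, ← algebraMap_smul L a y, smul_smul, mul_comm, hl.2, add_smul, one_smul,
    mul_smul, algebraMap_smul]

/-- The vector `(T - a)v` is a `b`-eigenvector, so `y = ρ⁻¹(T - a)v` is an `a`-eigenvector; then `(T
- a)(λy) = ρy = (T - a)v` makes `v - λy` an `a`-eigenvector as well. The argument does not need `a ≠
b`. -/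
theorem IsShift.exists_decomp {T : SemilinearAut K L V} {a b : K}
    (h : GoodPair a b) {lam : L} (hl : IsShift T a b lam) {v : V}
    (hv : T.toEquiv (T.toEquiv v - a • v) = b • (T.toEquiv v - a • v)) :
    ∃ x ∈ eig T a, ∃ y ∈ eig T a, v = x + lam • y := by
  have haL : algebraMap K L a ≠ 0 := by simpa using h.ne_zero
  have hr := hl.rho_ne_zero
  set ρ := (algebraMap K L b - algebraMap K L a) * lam + 1 with hρ
  have e1 : algebraMap K L a * T.companion ρ = algebraMap K L b * ρ := by
    simp only [hρ, map_add, map_mul, map_sub, AlgEquiv.commutes, map_one]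
    linear_combination (algebraMap K L b - algebraMap K L a) * hl.2
  have hr' : T.companion ρ ≠ 0 := by simpa using hr
  set w := T.toEquiv v - a • v with hw
  have hy : ρ⁻¹ • w ∈ eig T a := by
    rw [mem_eig, T.map_smul, hv, ← algebraMap_smul L b, ← algebraMap_smul L a, smul_smul, smul_smul,
      map_inv₀]
    congr 1
    field_simp
    linear_combination -e1
  refine ⟨v - lam • ρ⁻¹ • w, ?_, ρ⁻¹ • w, hy, by abel⟩
  rw [mem_eig, map_sub, hl.map_smul hy]
  have e2 : w = ρ • ρ⁻¹ • w := by rw [smul_inv_smul₀ hr]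
  have e3 : T.toEquiv v = a • v + ρ • ρ⁻¹ • w := by rw [← e2, hw]; abel
  rw [e3, hρ]
  simp only [← algebraMap_smul L a, ← algebraMap_smul L b]
  module

end

/-! ### Hwise-fixed-5-spaces, and frames of h-planes -/

section

variable {K L V : Type*} [Field K] [Field L] [Algebra K L] [AddCommGroup V] [Module K V]
  [Module L V]

theorem sigma_span (T : SemilinearAut K L V) (v : V) : sigma T (K ∙ v) = K ∙ T.toEquiv v := by
  rw [sigma, Submodule.map_span, Set.image_singleton]; rfl

theorem sigma_eq_iff [FiniteDimensional K V] (T : SemilinearAut K L V) (W : Submodule K V) :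
    sigma T W = W ↔ ∀ w ∈ W, T.toEquiv w ∈ W := by
  constructor
  · intro h w hw
    have : T.toEquiv w ∈ sigma T W := Submodule.mem_map_of_mem (f := (T.toEquiv : V →ₗ[K] V)) hw
    rwa [h] at this
  · intro h
    refine Submodule.eq_of_le_of_finrank_eq ?_ (LinearEquiv.finrank_map_eq T.toEquiv W)
    rintro _ ⟨w, hw, rfl⟩
    exact h w hw

theorem sigma_span_eq_iff [FiniteDimensional K V] (T : SemilinearAut K L V) (v : V) :
    sigma T (K ∙ v) = (K ∙ v) ↔ T.toEquiv v ∈ K ∙ v := by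
  rw [sigma_eq_iff]
  refine ⟨fun h => h v (Submodule.mem_span_singleton_self v), fun h w hw => ?_⟩
  obtain ⟨c, rfl⟩ := Submodule.mem_span_singleton.1 hw
  rw [map_smul]
  exact Submodule.smul_mem _ _ h

theorem ptwiseFixed_iff [FiniteDimensional K V] (T : SemilinearAut K L V) (W : Submodule K V) :
    PtwiseFixed T W ↔ ∃ c : K, W ≤ eig T c := by
  constructor
  · intro h
    have h' : ∀ v ∈ W, T.toEquiv v ∈ K ∙ v := by
      intro v hv
      by_cases h0 : v = 0
      · simp [h0]
      · exact (sigma_span_eq_iff T v).1 (h _ (finrank_span_singleton h0) (by simpa using hv))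
    let f : W →ₗ[K] W := (T.toEquiv : V →ₗ[K] V).restrict (p := W) (q := W) (fun v hv =>
      (Submodule.span_singleton_le_iff_mem _ _).2 hv (h' v hv))
    obtain ⟨c, hc⟩ := exists_forall_smul_of_forall_mem_span f (fun v => by
      obtain ⟨c, hc⟩ := Submodule.mem_span_singleton.1 (h' v v.2)
      exact Submodule.mem_span_singleton.2 ⟨c, Subtype.ext hc⟩)
    refine ⟨c, fun v hv => mem_eig.2 ?_⟩
    exact congrArg Subtype.val (hc ⟨v, hv⟩)
  · rintro ⟨c, hc⟩ A hA hAW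
    obtain ⟨v, -, rfl⟩ := finrank_eq_one_iff_exists_span.1 hA
    rw [sigma_span_eq_iff, mem_eig.1 (hc (by simpa using hAW))]
    exact Submodule.smul_mem _ _ (Submodule.mem_span_singleton_self v)

theorem cube_eq_one_of_mem_eig {T : SemilinearAut K L V} (hT : IsRegular T) {c : K} {v : V}
    (hv : v ∈ eig T c) (h0 : v ≠ 0) : c ^ 3 = 1 := by
  have h := hT.cube v
  simp only [mem_eig.1 hv, map_smul, smul_smul] at h
  apply smul_left_injective K h0
  simp only [one_smul]
  rw [show c ^ 3 = c * c * c by ring, h]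

theorem eq_of_mem_eig {T : SemilinearAut K L V} {c d : K} {v : V}
    (hc : v ∈ eig T c) (hd : v ∈ eig T d) (h0 : v ≠ 0) : c = d := by
  rw [mem_eig] at hc hd
  exact smul_left_injective K h0 (hc.symm.trans hd)

/-- The map `T - c`. -/
def shiftMap (T : SemilinearAut K L V) (c : K) : V →ₗ[K] V :=
  (T.toEquiv : V →ₗ[K] V) - c • LinearMap.id

@[simp] theorem shiftMap_apply (T : SemilinearAut K L V) (c : K) (v : V) :
    shiftMap T c v = T.toEquiv v - c • v := rfl

theorem ker_shiftMap (T : SemilinearAut K L V) (c : K) :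
    LinearMap.ker (shiftMap T c) = eig T c := by
  ext v
  rw [LinearMap.mem_ker, shiftMap_apply, sub_eq_zero, mem_eig]

theorem finrank_range_shiftMap [FiniteDimensional K V] {T : SemilinearAut K L V} (hT : IsRegular T)
    {c : K} (hc : c ^ 3 = 1) : finrank K (LinearMap.range (shiftMap T c)) = 6 := by
  have := (shiftMap T c).finrank_range_add_finrank_ker
  rw [ker_shiftMap, hT.finrank_eig c hc, hT.finrank_space] at this
  omega

/-- Hyperplanes through `W` are functionals vanishing on `W`. All of them being fixed means that the
transpose of `T` acts on the annihilator of `W` as a scalar `c`, that is, `range (T - c) ⊆ W`;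
equality follows from dimensions. -/
theorem isHwiseFixed5Space_iff [FiniteDimensional K V] {T : SemilinearAut K L V}
    (hT : IsRegular T) (W : Submodule K V) :
    IsHwiseFixed5Space T W ↔ ∃ c : K, c ^ 3 = 1 ∧ W = LinearMap.range (shiftMap T c) := by
  constructor
  · rintro ⟨hW, h⟩
    have hf : ∀ f ∈ W.dualAnnihilator, f.comp (T.toEquiv : V →ₗ[K] V) ∈ K ∙ f := by
      intro f hf
      by_cases h0 : f = 0
      · simp [h0]
      have hk : finrank K (LinearMap.ker f) = 8 := by
        have := Module.Dual.finrank_ker_add_one_of_ne_zero h0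
        rw [hT.finrank_space] at this
        omega
      have hle : W ≤ LinearMap.ker f := fun w hw =>
        (Submodule.mem_dualAnnihilator f).1 hf w hw
      have hinv := (sigma_eq_iff T _).1 (h _ hk hle)
      have := mem_span_of_iInf_ker_le_ker (ι := Unit) (L := fun _ => f)
        (K := f.comp (T.toEquiv : V →ₗ[K] V)) (by
          intro v hv
          simp only [Submodule.mem_iInf, forall_const] at hv
          exact hinv v hv)
      simpa using this
    let D : Dual K V →ₗ[K] Dual K V := (T.toEquiv : V →ₗ[K] V).dualMap
    have hD : ∀ f ∈ W.dualAnnihilator, D f ∈ W.dualAnnihilator := fun f hfW =>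
      (Submodule.span_singleton_le_iff_mem _ _).2 hfW (hf f hfW)
    obtain ⟨c, hc⟩ := exists_forall_smul_of_forall_mem_span (V := W.dualAnnihilator) (D.restrict hD) (fun f => by
      obtain ⟨c, hc⟩ := Submodule.mem_span_singleton.1 (hf f.1 f.2)
      exact Submodule.mem_span_singleton.2 ⟨c, Subtype.ext hc⟩)
    have hle : LinearMap.range (shiftMap T c) ≤ W := by
      rw [← Subspace.dualAnnihilator_dualCoannihilator_eq (W := W)]
      rintro _ ⟨v, rfl⟩
      rw [Submodule.mem_dualCoannihilator]
      intro f hfW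
      have := congrArg (fun g : W.dualAnnihilator => g.1 v) (hc ⟨f, hfW⟩)
      have h2 : f (T.toEquiv v) = c • f v := this
      rw [shiftMap_apply, map_sub, map_smul, h2, sub_self]
    -- A range of dimension at most 6 in a space of dimension 9 leaves a nonzero kernel, so `c` is
    -- an eigenvalue of `T`.
    have hc3 : c ^ 3 = 1 := by
      have h1 := (shiftMap T c).finrank_range_add_finrank_ker
      have h2 := Submodule.finrank_mono hle
      rw [ker_shiftMap, hT.finrank_space] at h1
      have h3 : eig T c ≠ ⊥ := by
        intro hb
        rw [hb, finrank_bot] at h1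
        omega
      obtain ⟨v, hv, h0⟩ := Submodule.exists_mem_ne_zero_of_ne_bot h3
      exact cube_eq_one_of_mem_eig hT hv h0
    exact ⟨c, hc3, (Submodule.eq_of_le_of_finrank_eq hle
      (by rw [finrank_range_shiftMap hT hc3, hW])).symm⟩
  · rintro ⟨c, hc, rfl⟩
    refine ⟨finrank_range_shiftMap hT hc, fun H _ hle => ?_⟩
    rw [sigma_eq_iff]
    intro w hw
    have h1 : T.toEquiv w - c • w ∈ H := hle ⟨w, rfl⟩
    simpa using H.add_mem h1 (H.smul_mem c hw)

/-- `π` is spanned by the line `ℓ` of eigenvectors for `a` and a vector on which `T` acts as `b`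
modulo `ℓ`, and is not fixed pointwise. -/
structure IsFrame (T : SemilinearAut K L V) (a b : K) (ℓ π : Submodule K V) : Prop where
  le_eig : ℓ ≤ eig T a
  finrank_line : finrank K ℓ = 2
  le : ℓ ≤ π
  finrank_plane : finrank K π = 3
  sub_mem : ∀ v ∈ π, T.toEquiv v - b • v ∈ ℓ
  not_le : ¬ π ≤ eig T a

namespace IsFrame

variable {T : SemilinearAut K L V} {a b : K} {ℓ π : Submodule K V}

theorem map_mem (hF : IsFrame T a b ℓ π) {v : V} (hv : v ∈ π) : T.toEquiv v ∈ π := by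
  simpa using π.add_mem (hF.le (hF.sub_mem v hv)) (π.smul_mem b hv)

theorem map_sub_eq (hF : IsFrame T a b ℓ π) {v : V} (hv : v ∈ π) :
    T.toEquiv (T.toEquiv v - b • v) = a • (T.toEquiv v - b • v) :=
  mem_eig.1 (hF.le_eig (hF.sub_mem v hv))

theorem map_sub_eq' (hF : IsFrame T a b ℓ π) {v : V} (hv : v ∈ π) :
    T.toEquiv (T.toEquiv v - a • v) = b • (T.toEquiv v - a • v) := by
  have := hF.map_sub_eq hv
  rw [map_sub, map_smul] at this ⊢
  rw [sub_eq_iff_eq_add] at this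
  rw [this]
  module

theorem exists_mem_ne_zero (hF : IsFrame T a b ℓ π) : ∃ e ∈ ℓ, e ≠ 0 :=
  Submodule.exists_mem_ne_zero_of_ne_bot (by
    rintro rfl
    have := hF.finrank_line
    simp at this)

theorem exists_notMem (hF : IsFrame T a b ℓ π) : ∃ v ∈ π, v ∉ ℓ := by
  by_contra! hcon
  exact hF.not_le (fun v hv => hF.le_eig (hcon v hv))

variable [FiniteDimensional K V]

theorem sigma_eq (hF : IsFrame T a b ℓ π) : sigma T π = π :=
  (sigma_eq_iff T π).2 fun _ => hF.map_mem

theorem not_ptwiseFixed (hF : IsFrame T a b ℓ π) : ¬ PtwiseFixed T π := by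
  rw [ptwiseFixed_iff]
  rintro ⟨c, hc⟩
  obtain ⟨e, he, h0⟩ := hF.exists_mem_ne_zero
  have := eq_of_mem_eig (hF.le_eig he) (hc (hF.le he)) h0
  subst this
  exact hF.not_le hc

theorem finrank_inf (hF : IsFrame T a b ℓ π) {m : Submodule K V} (hm : finrank K m = 2)
    (hmπ : m ≤ π) (hne : m ≠ ℓ) : m ⊔ ℓ = π ∧ finrank K (m ⊓ ℓ : Submodule K V) = 1 := by
  have h1 := Submodule.finrank_sup_add_finrank_inf_eq m ℓ
  have h2 : m ⊔ ℓ ≤ π := sup_le hmπ hF.le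
  have h3 := Submodule.finrank_mono h2
  have h4 : finrank K (m ⊓ ℓ : Submodule K V) ≤ 1 := by
    by_contra hcon
    have h5 : m ⊓ ℓ = m := Submodule.eq_of_le_of_finrank_le inf_le_left (by omega)
    have h6 : m ⊓ ℓ = ℓ := Submodule.eq_of_le_of_finrank_le inf_le_right
      (by rw [hF.finrank_line]; omega)
    exact hne (h5.symm.trans h6)
  rw [hm, hF.finrank_line] at h1
  rw [hF.finrank_plane] at h3
  exact ⟨Submodule.eq_of_le_of_finrank_le h2 (by rw [hF.finrank_plane]; omega), by omega⟩

theorem eq_of_ptwiseFixed (hF : IsFrame T a b ℓ π) {m : Submodule K V} (hm : finrank K m = 2)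
    (hmπ : m ≤ π) {c : K} (hc : m ≤ eig T c) : m = ℓ := by
  by_contra hne
  obtain ⟨h1, h2⟩ := hF.finrank_inf hm hmπ hne
  obtain ⟨e, h0, he⟩ := finrank_eq_one_iff_exists_span.1 h2
  have hmem : e ∈ m ⊓ ℓ := he ▸ Submodule.mem_span_singleton_self e
  have := eq_of_mem_eig (hF.le_eig hmem.2) (hc hmem.1) h0
  subst this
  exact hF.not_le (h1 ▸ sup_le hc hF.le_eig)

theorem eq_sup (hF : IsFrame T a b ℓ π) {v : V} (hv : v ∈ π) (hvl : v ∉ ℓ) : ℓ ⊔ K ∙ v = π :=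
  Submodule.eq_of_le_of_finrank_eq (sup_le hF.le (by simpa using hv))
    (by rw [finrank_sup_span_singleton hvl 2 hF.finrank_line, hF.finrank_plane])

/-- `ℓ` is the only pointwise fixed line of `π`, `a` is the eigenvalue on it, and `b` is the action
of `T` on `π / ℓ`. -/
theorem unique (hF : IsFrame T a b ℓ π) {a' b' : K} {ℓ' : Submodule K V}
    (hF' : IsFrame T a' b' ℓ' π) : a = a' ∧ b = b' ∧ ℓ = ℓ' := by
  have hl : ℓ = ℓ' := hF'.eq_of_ptwiseFixed hF.finrank_line hF.le hF.le_eig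
  subst hl
  obtain ⟨e, he, h0⟩ := hF.exists_mem_ne_zero
  refine ⟨eq_of_mem_eig (hF.le_eig he) (hF'.le_eig he) h0, ?_, rfl⟩
  obtain ⟨v, hv, hvl⟩ := hF.exists_notMem
  by_contra hne
  apply hvl
  have h1 : (b' - b) • v ∈ ℓ := by
    have := ℓ.sub_mem (hF.sub_mem v hv) (hF'.sub_mem v hv)
    rwa [show T.toEquiv v - b • v - (T.toEquiv v - b' • v) = (b' - b) • v by module] at this
  have h2 := ℓ.smul_mem (b' - b)⁻¹ h1
  rwa [inv_smul_smul₀ (sub_ne_zero.2 (Ne.symm hne))] at h2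

end IsFrame

/-- `π` lies in the range of some `T - c`, and `(T² + cT + c²)(T - c) = T³ - c³ = 0`. -/
theorem IsHPlane.exists_quadratic [FiniteDimensional K V] {T : SemilinearAut K L V}
    (hT : IsRegular T) {π : Submodule K V} (hπ : IsHPlane T π) :
    ∃ c : K, c ^ 3 = 1 ∧
      ∀ v ∈ π, T.toEquiv (T.toEquiv v) + c • T.toEquiv v + c ^ 2 • v = 0 := by
  obtain ⟨-, -, -, W, hW, hle⟩ := hπ
  obtain ⟨c, hc, rfl⟩ := (isHwiseFixed5Space_iff hT W).1 hW
  refine ⟨c, hc, fun v hv => ?_⟩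
  obtain ⟨w, rfl⟩ := hle hv
  have e : c ^ 3 • w = w := by rw [hc, one_smul]
  simp only [shiftMap_apply, map_sub, map_smul, hT.cube w]
  have e' : w - c ^ 3 • w = 0 := by rw [e, sub_self]
  linear_combination (norm := module) e'

theorem isFrame_of_two_le [FiniteDimensional K V] {T : SemilinearAut K L V} {a b : K}
    {π : Submodule K V} (hd : finrank K π = 3) (hp : ¬ PtwiseFixed T π)
    (hinv : ∀ v ∈ π, T.toEquiv v ∈ π)
    (hsub : ∀ v ∈ π, T.toEquiv v - b • v ∈ eig T a)
    (h2 : 2 ≤ finrank K (π ⊓ eig T a : Submodule K V)) :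
    IsFrame T a b (π ⊓ eig T a) π := by
  have hn : ¬ π ≤ eig T a := fun h => hp ((ptwiseFixed_iff T π).2 ⟨a, h⟩)
  refine ⟨inf_le_right, le_antisymm ?_ h2, inf_le_left, hd,
    fun v hv => ⟨π.sub_mem (hinv v hv) (π.smul_mem b hv), hsub v hv⟩, hn⟩
  by_contra hcon
  exact hn (inf_eq_left.1 (Submodule.eq_of_le_of_finrank_le inf_le_left (by omega)))

/-- With `a = ωc` and `b = ω²c` the quadratic is `(X - a)(X - b)`. On `π` the map `T - b` has range
in `eig T a` and kernel in `eig T b`; the dimensions add up to 3, so `π` meets one of the two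
eigenspaces in dimension at least 2. In characteristic 3 one has `ω = 1` and `a = b`. -/
theorem IsHPlane.exists_isFrame [FiniteDimensional K V] {T : SemilinearAut K L V}
    (hT : IsRegular T) {ω : K} (hω : ω ^ 2 + ω + 1 = 0) {π : Submodule K V}
    (hπ : IsHPlane T π) : ∃ a b ℓ, GoodPair a b ∧ IsFrame T a b ℓ π := by
  obtain ⟨c, hc, hq⟩ := hπ.exists_quadratic hT
  obtain ⟨hd, hs, hp, -⟩ := hπ
  have hinv := (sigma_eq_iff T π).1 hs
  have hg : GoodPair (ω * c) (ω ^ 2 * c) :=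
    ⟨by linear_combination hc + c ^ 3 * (ω - 1) * hω,
      by linear_combination (c ^ 2 * ω ^ 2) * hω⟩
  set a := ω * c with ha
  set b := ω ^ 2 * c with hb
  have hab : a + b = -c := by rw [ha, hb]; linear_combination c * hω
  have hab2 : a * b = c ^ 2 := by rw [ha, hb]; linear_combination c ^ 2 * (ω - 1) * hω
  have h1 : ∀ v ∈ π, T.toEquiv v - b • v ∈ eig T a := by
    intro v hv
    rw [mem_eig, map_sub, map_smul]
    have e1 : (a + b) • T.toEquiv v = -c • T.toEquiv v := by rw [hab]
    have e2 : (a * b) • v = c ^ 2 • v := by rw [hab2]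
    linear_combination (norm := module) hq v hv - e1 + e2
  have h2 : ∀ v ∈ π, T.toEquiv v - a • v ∈ eig T b := by
    intro v hv
    rw [mem_eig, map_sub, map_smul]
    have e1 : (a + b) • T.toEquiv v = -c • T.toEquiv v := by rw [hab]
    have e2 : (a * b) • v = c ^ 2 • v := by rw [hab2]
    linear_combination (norm := module) hq v hv - e1 + e2
  have h3 := ((shiftMap T b).domRestrict π).finrank_range_add_finrank_ker
  have h4 : LinearMap.range ((shiftMap T b).domRestrict π) ≤ π ⊓ eig T a := by
    rintro _ ⟨⟨v, hv⟩, rfl⟩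
    exact ⟨π.sub_mem (hinv v hv) (π.smul_mem b hv), h1 v hv⟩
  have h5 : (LinearMap.ker ((shiftMap T b).domRestrict π)).map π.subtype ≤ π ⊓ eig T b := by
    rintro _ ⟨⟨v, hv⟩, hk, rfl⟩
    rw [← ker_shiftMap]
    exact ⟨hv, hk⟩
  have h4' := Submodule.finrank_mono h4
  have h5' := Submodule.finrank_mono h5
  rw [finrank_map_subtype] at h5'
  rw [hd] at h3
  by_cases h6 : 2 ≤ finrank K (π ⊓ eig T a : Submodule K V)
  · exact ⟨a, b, _, hg, isFrame_of_two_le hd hp hinv h1 h6⟩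
  · exact ⟨b, a, _, hg.symm, isFrame_of_two_le hd hp hinv h2 (by omega)⟩

variable [IsScalarTower K L V]

/-- The factors of `X³ - 1` need not be coprime, so dimensions are used: `range (T - c) ⊆ ker (T -
b)(T - a) ⊆ eig T a + λ eig T a`, where `c = -(a + b)`, the first space has dimension 6 and the last
at most 6. -/
theorem mem_range_shiftMap [FiniteDimensional K V] {T : SemilinearAut K L V} (hT : IsRegular T)
    {a b : K} (h : GoodPair a b) {v : V}
    (hv : T.toEquiv (T.toEquiv v - a • v) = b • (T.toEquiv v - a • v)) :
    v ∈ LinearMap.range (shiftMap T (-(a + b))) := by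
  obtain ⟨lam, hl⟩ := exists_isShift hT h
  let S : Submodule K V := eig T a ⊔ (eig T a).map (DistribSMul.toLinearMap K V lam)
  have hle : LinearMap.range (shiftMap T (-(a + b))) ≤ LinearMap.ker (shiftMap T b ∘ₗ shiftMap T a) := by
    rintro _ ⟨v, rfl⟩
    have h3 := hT.cube v
    have ha3 : a ^ 3 • v = v := by rw [h.1, one_smul]
    have h2 : b ^ 2 = -(a ^ 2 + a * b) := by linear_combination h.2
    simp only [LinearMap.mem_ker, LinearMap.comp_apply, shiftMap_apply, map_sub, map_smul, h3]
    have e : v - (a ^ 3) • v = 0 := by rw [ha3, sub_self]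
    have h4 : a * b ^ 2 = -(a ^ 3 + a ^ 2 * b) := by rw [h2]; ring
    have e2 : (a ^ 2 + a * b + b ^ 2) • T.toEquiv v = 0 := by rw [h.2, zero_smul]
    have e3 : (a ^ 2 + a * b + b ^ 2) • a • v = 0 := by rw [h.2, zero_smul]
    linear_combination (norm := module) e - e2 + e3
  have hker : LinearMap.ker (shiftMap T b ∘ₗ shiftMap T a) ≤ S := by
    intro v hv
    simp only [LinearMap.mem_ker, LinearMap.comp_apply, shiftMap_apply] at hv
    obtain ⟨x, hx, y, hy, rfl⟩ := hl.exists_decomp h (sub_eq_zero.1 hv)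
    exact Submodule.add_mem_sup hx (Submodule.mem_map_of_mem (f := DistribSMul.toLinearMap K V lam) hy)
  have hS : finrank K S ≤ 6 := by
    simp only [S]
    have h1 := Submodule.finrank_add_le_finrank_add_finrank (eig T a)
      ((eig T a).map (DistribSMul.toLinearMap K V lam))
    have h2 := Submodule.finrank_map_le (DistribSMul.toLinearMap K V lam) (eig T a)
    rw [hT.finrank_eig a h.1] at h1 h2
    omega
  have heq := Submodule.eq_of_le_of_finrank_le hle (by
    rw [finrank_range_shiftMap hT h.third]
    exact (Submodule.finrank_mono hker).trans hS)
  rw [heq, LinearMap.mem_ker, LinearMap.comp_apply, shiftMap_apply, shiftMap_apply, hv, sub_self]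

theorem IsFrame.isHPlane [FiniteDimensional K V] {T : SemilinearAut K L V} (hT : IsRegular T)
    {a b : K} (h : GoodPair a b) {ℓ π : Submodule K V} (hF : IsFrame T a b ℓ π) :
    IsHPlane T π :=
  ⟨hF.finrank_plane, hF.sigma_eq, hF.not_ptwiseFixed, _,
    (isHwiseFixed5Space_iff hT _).2 ⟨_, h.third, rfl⟩,
    fun _ hv => mem_range_shiftMap hT h (hF.map_sub_eq' hv)⟩

end

/-! ### Fixed points and fixed lines of a frame plane -/

section

variable {K L V : Type*} [Field K] [Field L] [Algebra K L] [AddCommGroup V] [Module K V]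
  [Module L V]

open Classical in
/-- The number of fixed points of a fixed line on which `T` has the eigenvalues `a` and `b` but is
not scalar, minus one. -/
noncomputable def eps (a b : K) : ℕ := if a = b then 0 else 1

/-- The points of `W` that are not fixed. -/
def nonfixed (T : SemilinearAut K L V) (W : Submodule K V) : Set (Submodule K V) :=
  {A | (finrank K A = 1 ∧ sigma T A ≠ A) ∧ A ≤ W}

theorem ncard_sep_add {α : Type*} [Finite α] (S : Set α) (P : α → Prop) :
    {x | x ∈ S ∧ P x}.ncard + {x | x ∈ S ∧ ¬ P x}.ncard = S.ncard := by
  rw [← Set.ncard_union_eq]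
  · congr 1
    ext x
    by_cases h : P x <;> simp [h]
  · rw [Set.disjoint_left]
    rintro x ⟨-, h⟩ ⟨-, h'⟩
    exact h' h

/-- The points off `E` are the `⟨v + u⟩` with `u ∈ E`. Such a point can be fixed only with
eigenvalue `b`, which amounts to `(b - a)u = Tv - bv`: one solution if `a ≠ b`, none if `a = b`, as
`v` is then not an eigenvector. -/
theorem ncard_nonfixed_sup [Finite V] {T : SemilinearAut K L V} {a b : K}
    {E : Submodule K V} {v : V} (hE : E ≤ eig T a) (hv : v ∉ E)
    (hsub : ∀ w ∈ E ⊔ K ∙ v, T.toEquiv w - b • w ∈ E) (hn : ¬ E ⊔ K ∙ v ≤ eig T a) :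
    (nonfixed T (E ⊔ K ∙ v)).ncard + eps a b = Nat.card E := by
  have h1 : nonfixed T (E ⊔ K ∙ v)
      = {A : Submodule K V | finrank K A = 1 ∧ A ≤ E ⊔ K ∙ v ∧ ¬ A ≤ E ∧ sigma T A ≠ A} := by
    ext A
    refine ⟨fun h => ⟨h.1.1, h.2, fun hA => h.1.2 ?_, h.1.2⟩, fun h => ⟨⟨h.1, h.2.2.2⟩, h.2.1⟩⟩
    exact ((ptwiseFixed_iff T A).2 ⟨a, hA.trans hE⟩) A h.1.1 le_rfl
  rw [h1, ncard_points_compl hv (fun A => sigma T A ≠ A)]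
  have hvm : v ∈ E ⊔ K ∙ v := Submodule.mem_sup_right (Submodule.mem_span_singleton_self v)
  have h2 : {u | u ∈ E ∧ ¬ sigma T (K ∙ (v + u)) ≠ (K ∙ (v + u))}.ncard = eps a b := by
    have h3 : {u | u ∈ E ∧ ¬ sigma T (K ∙ (v + u)) ≠ (K ∙ (v + u))}
        = {u | u ∈ E ∧ (b - a) • u = T.toEquiv v - b • v} := by
      ext u
      simp only [Set.mem_ofPred_eq, not_not, sigma_span_eq_iff]
      refine and_congr_right fun hu => ?_
      have hT : T.toEquiv u = a • u := mem_eig.1 (hE hu)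
      constructor
      · intro h
        obtain ⟨k, hk⟩ := Submodule.mem_span_singleton.1 h
        have h4 : (k - b) • (v + u) ∈ E := by
          rw [sub_smul, hk]
          exact hsub _ (add_mem hvm (Submodule.mem_sup_left hu))
        have h5 : k = b := by
          by_contra hne
          have := E.smul_mem (k - b)⁻¹ h4
          rw [inv_smul_smul₀ (sub_ne_zero.2 hne)] at this
          exact hv (by simpa using E.sub_mem this hu)
        subst h5
        rw [map_add, hT] at hk
        linear_combination (norm := module) hk
      · intro h
        refine Submodule.mem_span_singleton.2 ⟨b, ?_⟩
        rw [map_add, hT]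
        linear_combination (norm := module) h
    rw [h3, eps]
    split_ifs with hab
    · subst hab
      rw [Set.ncard_eq_zero]
      ext u
      simp only [Set.mem_ofPred_eq, Set.mem_empty_iff_false, iff_false, not_and, sub_self, zero_smul]
      intro _ h
      apply hn
      refine sup_le hE ?_
      rw [Submodule.span_singleton_le_iff_mem, mem_eig]
      exact sub_eq_zero.1 h.symm
    · rw [Set.ncard_eq_one]
      have hba : b - a ≠ 0 := sub_ne_zero.2 (Ne.symm hab)
      refine ⟨(b - a)⁻¹ • (T.toEquiv v - b • v), ?_⟩
      ext u
      simp only [Set.mem_ofPred_eq, Set.mem_singleton_iff, eq_inv_smul_iff₀ hba,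
        and_iff_right_iff_imp]
      intro h
      have := E.smul_mem (b - a)⁻¹ (hsub v hvm)
      rwa [← h, inv_smul_smul₀ hba] at this
  rw [← h2]
  exact ncard_sep_add (E : Set V) (fun u => sigma T (K ∙ (v + u)) ≠ (K ∙ (v + u)))

theorem natCard_submodule [Finite V] (W : Submodule K V) :
    Nat.card W = Nat.card K ^ finrank K W :=
  Module.natCard_eq_pow_finrank

theorem exists_eq_sup_span [FiniteDimensional K V] {E m : Submodule K V} {d : ℕ} (hle : E ≤ m)
    (hE : finrank K E = d) (hm : finrank K m = d + 1) : ∃ v ∈ m, v ∉ E ∧ m = E ⊔ K ∙ v := by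
  obtain ⟨v, hv, hvE⟩ : ∃ v ∈ m, v ∉ E := by
    by_contra! hcon
    have := le_antisymm hle hcon
    subst this
    omega
  exact ⟨v, hv, hvE, (Submodule.eq_of_le_of_finrank_eq (sup_le hle (by simpa using hv))
    (by rw [finrank_sup_span_singleton hvE d hE, hm])).symm⟩

theorem ncard_nonfixed [Finite V] {T : SemilinearAut K L V} {a b : K} {d : ℕ}
    {E m : Submodule K V} (hE : E ≤ eig T a) (hle : E ≤ m) (hdE : finrank K E = d)
    (hdm : finrank K m = d + 1) (hsub : ∀ w ∈ m, T.toEquiv w - b • w ∈ E)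
    (hn : ¬ m ≤ eig T a) : (nonfixed T m).ncard + eps a b = Nat.card K ^ d := by
  obtain ⟨v, hv, hvE, rfl⟩ := exists_eq_sup_span hle hdE hdm
  rw [ncard_nonfixed_sup hE hvE hsub hn, natCard_submodule, hdE]

namespace IsFrame

variable {T : SemilinearAut K L V} {a b : K} {ℓ π : Submodule K V}

theorem ncard_nonfixed [Finite V] (hF : IsFrame T a b ℓ π) :
    (nonfixed T π).ncard + eps a b = Nat.card K ^ 2 :=
  Bose.ncard_nonfixed hF.le_eig hF.le hF.finrank_line hF.finrank_plane hF.sub_mem hF.not_le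

theorem ncard_fixed [Finite K] [Finite V] (hF : IsFrame T a b ℓ π) :
    {A | IsFixedPoint T A ∧ A ≤ π}.ncard = Nat.card K + 1 + eps a b := by
  have h1 := hF.ncard_nonfixed
  have h2 := ncard_sep_add {A : Submodule K V | finrank K A = 1 ∧ A ≤ π} (fun A => sigma T A = A)
  rw [ncard_points_le hF.finrank_plane] at h2
  have e1 : {A : Submodule K V | A ∈ {A : Submodule K V | finrank K A = 1 ∧ A ≤ π} ∧ sigma T A = A}
      = {A | IsFixedPoint T A ∧ A ≤ π} := by
    ext A
    simp only [IsFixedPoint, Set.mem_ofPred_eq]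
    tauto
  have e2 : {A : Submodule K V | A ∈ {A : Submodule K V | finrank K A = 1 ∧ A ≤ π} ∧ ¬ sigma T A = A}
      = nonfixed T π := by
    ext A
    simp only [nonfixed, Set.mem_ofPred_eq, Ne]
    tauto
  rw [e1, e2] at h2
  simp only [Finset.sum_range_succ, Finset.sum_range_zero, pow_zero, pow_one] at h2
  omega

theorem ncard_ptwiseFixedLine [FiniteDimensional K V] (hF : IsFrame T a b ℓ π) :
    {l | IsPtwiseFixedLine T l ∧ l ≤ π}.ncard = 1 := by
  rw [Set.ncard_eq_one]
  refine ⟨ℓ, ?_⟩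
  ext m
  constructor
  · rintro ⟨⟨hm, hp⟩, hle⟩
    obtain ⟨c, hc⟩ := (ptwiseFixed_iff T m).1 hp
    exact hF.eq_of_ptwiseFixed hm hle hc
  · rintro rfl
    exact ⟨⟨hF.finrank_line, (ptwiseFixed_iff T m).2 ⟨a, hF.le_eig⟩⟩, hF.le⟩

/-- Through a non-fixed point `A` of `π` there is exactly one fixed line, spanned by `A` and its
image. -/
theorem eq_span_pair [FiniteDimensional K V] {w : V} (hw : T.toEquiv w ∉ K ∙ w)
    {m : Submodule K V} (hm : finrank K m = 2) (hs : sigma T m = m) (hwm : w ∈ m) :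
    (K ∙ w) ⊔ (K ∙ T.toEquiv w) = m := by
  have h0 : w ≠ 0 := by rintro rfl; simp at hw
  refine Submodule.eq_of_le_of_finrank_eq (sup_le ?_ ?_) ?_
  · simpa using hwm
  · simpa using (sigma_eq_iff T m).1 hs w hwm
  · rw [finrank_sup_span_singleton hw 1 (finrank_span_singleton h0), hm]

theorem map_map_mem (hF : IsFrame T a b ℓ π) {w : V} (hw : w ∈ π) :
    T.toEquiv (T.toEquiv w) ∈ (K ∙ w) ⊔ (K ∙ T.toEquiv w) := by
  have h := hF.map_sub_eq hw
  rw [map_sub, map_smul] at h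
  rw [Submodule.mem_sup]
  refine ⟨(-(a * b)) • w, Submodule.smul_mem _ _ (Submodule.mem_span_singleton_self _),
    (a + b) • T.toEquiv w, Submodule.smul_mem _ _ (Submodule.mem_span_singleton_self _), ?_⟩
  linear_combination (norm := module) -h

theorem sigma_span_pair [FiniteDimensional K V] (hF : IsFrame T a b ℓ π) {w : V} (hw : w ∈ π) :
    sigma T ((K ∙ w) ⊔ (K ∙ T.toEquiv w)) = (K ∙ w) ⊔ (K ∙ T.toEquiv w) := by
  rw [sigma_eq_iff]
  intro x hx
  obtain ⟨y, hy, z, hz, rfl⟩ := Submodule.mem_sup.1 hx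
  obtain ⟨c, rfl⟩ := Submodule.mem_span_singleton.1 hy
  obtain ⟨d, rfl⟩ := Submodule.mem_span_singleton.1 hz
  rw [map_add, map_smul, map_smul]
  refine add_mem (Submodule.smul_mem _ _ (Submodule.mem_sup_right
    (Submodule.mem_span_singleton_self _))) (Submodule.smul_mem _ _ (hF.map_map_mem hw))

/-- The fixed lines of `π` that are not fixed pointwise. -/
def fixedLines (T : SemilinearAut K L V) (ℓ π : Submodule K V) : Set (Submodule K V) :=
  {m | finrank K m = 2 ∧ sigma T m = m ∧ m ≠ ℓ ∧ m ≤ π}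

theorem not_le_eig_of_mem [FiniteDimensional K V] (hF : IsFrame T a b ℓ π) {m : Submodule K V}
    (hm : m ∈ fixedLines T ℓ π) : ¬ m ≤ eig T a :=
  fun h => hm.2.2.1 (hF.eq_of_ptwiseFixed hm.1 hm.2.2.2 h)

theorem ncard_nonfixed_line [Finite V] (hF : IsFrame T a b ℓ π) {m : Submodule K V}
    (hm : m ∈ fixedLines T ℓ π) : (nonfixed T m).ncard + eps a b = Nat.card K := by
  have h := Bose.ncard_nonfixed (T := T) (a := a) (b := b) (d := 1) (E := m ⊓ ℓ) (m := m)
    (inf_le_right.trans hF.le_eig) inf_le_left (hF.finrank_inf hm.1 hm.2.2.2 hm.2.2.1).2 hm.1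
    (fun w hw => ⟨m.sub_mem ((sigma_eq_iff T m).1 hm.2.1 w hw) (m.smul_mem b hw),
      hF.sub_mem w (hm.2.2.2 hw)⟩) (hF.not_le_eig_of_mem hm)
  rwa [pow_one] at h

theorem mem_fixedLines_of_nonfixed [FiniteDimensional K V] (hF : IsFrame T a b ℓ π)
    {m A : Submodule K V} (hm : finrank K m = 2) (hs : sigma T m = m) (hmπ : m ≤ π)
    (hA : A ∈ nonfixed T m) : m ∈ fixedLines T ℓ π := by
  refine ⟨hm, hs, ?_, hmπ⟩
  rintro rfl
  exact hA.1.2 ((ptwiseFixed_iff T m).2 ⟨a, hF.le_eig⟩ A hA.1.1 hA.2)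

theorem mem_nonfixed_iff [FiniteDimensional K V] {A W : Submodule K V} :
    A ∈ nonfixed T W ↔ ∃ w ∈ W, T.toEquiv w ∉ (K ∙ w) ∧ A = K ∙ w := by
  constructor
  · rintro ⟨⟨h1, h2⟩, h3⟩
    obtain ⟨w, h0, rfl⟩ := finrank_eq_one_iff_exists_span.1 h1
    exact ⟨w, by simpa using h3, fun h => h2 ((sigma_span_eq_iff T w).2 h), rfl⟩
  · rintro ⟨w, hw, hT, rfl⟩
    refine ⟨⟨finrank_span_singleton ?_, fun h => hT ((sigma_span_eq_iff T w).1 h)⟩, by simpa using hw⟩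
    rintro rfl
    simp at hT

/-- Double counting: each of the `q² - eps` non-fixed points `⟨w⟩` lies on exactly one fixed line
`⟨w, Tw⟩`, and each such line carries `q - eps` non-fixed points. -/
theorem ncard_fixedLines [Finite K] [Finite V] (hF : IsFrame T a b ℓ π) :
    (fixedLines T ℓ π).ncard = Nat.card K + eps a b := by
  have hK : 1 < Nat.card K := Finite.one_lt_card
  have h1 := hF.ncard_nonfixed
  have h2 := ncard_eq_mul_of_fibers (S := nonfixed T π) (T := fixedLines T ℓ π)
    (fun A m => A ≤ m) (Nat.card K - eps a b) (by
      intro A hA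
      obtain ⟨w, hw, hT, rfl⟩ := mem_nonfixed_iff.1 hA
      have h0 : w ≠ 0 := by rintro rfl; simp at hT
      refine ⟨(K ∙ w) ⊔ (K ∙ T.toEquiv w), ⟨?_, le_sup_left⟩, ?_⟩
      · refine hF.mem_fixedLines_of_nonfixed (A := K ∙ w) ?_ (hF.sigma_span_pair hw)
          (sup_le (by simpa using hw) (by simpa using hF.map_mem hw)) ⟨hA.1, le_sup_left⟩
        exact finrank_sup_span_singleton hT 1 (finrank_span_singleton h0)
      · rintro m ⟨hm, hle⟩
        exact (eq_span_pair hT hm.1 hm.2.1 (by simpa using hle)).symm) (by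
      intro m hm
      have : {A | A ∈ nonfixed T π ∧ A ≤ m} = nonfixed T m := by
        ext A
        exact ⟨fun h => ⟨h.1.1, h.2⟩, fun h => ⟨⟨h.1, h.2.trans hm.2.2.2⟩, h.2⟩⟩
      rw [this]
      have := hF.ncard_nonfixed_line hm
      omega)
  rw [h2] at h1
  unfold eps at h1 ⊢
  split_ifs at h1 ⊢ with hab
  · simp only [Nat.sub_zero, add_zero] at h1 ⊢
    exact Nat.eq_of_mul_eq_mul_right (by omega) (h1.trans (pow_two _))
  -- With `eps = 1` the factor `q - 1 = k + 1` is cancelled from `q² - 1`; writing `q = k + 2`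
  -- avoids truncated subtraction.
  · obtain ⟨k, hk⟩ : ∃ k, Nat.card K = k + 2 := ⟨Nat.card K - 2, by omega⟩
    rw [hk] at h1 ⊢
    have h3 : k + 2 - 1 = k + 1 := by omega
    rw [h3] at h1
    apply Nat.eq_of_mul_eq_mul_right (show 0 < k + 1 by omega)
    nlinarith

end IsFrame

end

/-! ### Type I and type II points of a frame plane -/

section

variable {K L V : Type*} [Field K] [Field L] [Algebra K L] [AddCommGroup V] [Module K V]
  [Module L V]

theorem phi_span (T : SemilinearAut K L V) (v : V) :
    phi T (Submodule.span L {v}) = Submodule.span L {T.toEquiv v} := by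
  ext w
  constructor
  · rintro ⟨x, hx, rfl⟩
    obtain ⟨c, rfl⟩ := Submodule.mem_span_singleton.1 hx
    exact Submodule.mem_span_singleton.2 ⟨T.companion c, (T.map_smul c v).symm⟩
  · intro h
    obtain ⟨c, rfl⟩ := Submodule.mem_span_singleton.1 h
    refine ⟨T.companion.symm c • v, Submodule.mem_span_singleton.2 ⟨_, rfl⟩, ?_⟩
    rw [T.map_smul, AlgEquiv.apply_symm_apply]

theorem IsRegular.map_ne_zero {T : SemilinearAut K L V} {v : V} (h : v ≠ 0) :
    T.toEquiv v ≠ 0 := by simpa using h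

theorem phi_span_eq_iff {T : SemilinearAut K L V} {v : V} (h : v ≠ 0) :
    phi T (Submodule.span L {v}) = Submodule.span L {v} ↔ ∃ μ : L, T.toEquiv v = μ • v := by
  rw [phi_span]
  constructor
  · intro h
    have : T.toEquiv v ∈ Submodule.span L {v} := h ▸ Submodule.mem_span_singleton_self _
    obtain ⟨μ, hμ⟩ := Submodule.mem_span_singleton.1 this
    exact ⟨μ, hμ.symm⟩
  · rintro ⟨μ, hμ⟩
    exact span_singleton_eq_of_mem (IsRegular.map_ne_zero h)
      (Submodule.mem_span_singleton.2 ⟨μ, hμ.symm⟩)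

theorem eq_span_of_mem {P : Submodule L V} (hP : finrank L P = 1) {w : V} (h0 : w ≠ 0)
    (hw : w ∈ P) : P = Submodule.span L {w} := by
  obtain ⟨v, -, rfl⟩ := finrank_eq_one_iff_exists_span.1 hP
  exact (span_singleton_eq_of_mem h0 hw).symm

variable [IsScalarTower K L V]

theorem span_pair_le_restrictScalars (w v : V) :
    (K ∙ w) ⊔ (K ∙ v) ≤ (Submodule.span L {w, v}).restrictScalars K :=
  sup_le (by simpa using Submodule.subset_span (by simp : w ∈ ({w, v} : Set V)))
    (by simpa using Submodule.subset_span (by simp : v ∈ ({w, v} : Set V)))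

namespace IsFrame

variable {T : SemilinearAut K L V} {a b : K} {ℓ π : Submodule K V}

omit [IsScalarTower K L V] in
theorem collinearOrbit (hT : IsRegular T) (hF : IsFrame T a b ℓ π) {w : V} (hw : w ∈ π)
    (hn : T.toEquiv w ∉ K ∙ w) : CollinearOrbit T (K ∙ w) := by
  have h0 : w ≠ 0 := by rintro rfl; simp at hn
  refine ⟨finrank_span_singleton h0, ?_⟩
  rw [sigma_span, sigma_span]
  refine collinear_orbit (RingEquiv.refl K) T.toEquiv (fun c v => map_smul _ c v) hT.cube h0 hn ?_
  rw [Submodule.span_insert]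
  exact hF.map_map_mem hw

theorem isIColPoint_span_iff (hT : IsRegular T) (hF : IsFrame T a b ℓ π) {w : V} (hw : w ∈ π)
    (hn : T.toEquiv w ∉ K ∙ w) : IsIColPoint T (K ∙ w) ↔ ∃ μ : L, T.toEquiv w = μ • w := by
  have h0 : w ≠ 0 := by rintro rfl; simp at hn
  constructor
  · rintro ⟨-, α, ⟨P, ⟨hP1, hP2⟩, rfl⟩, hle⟩
    rw [Submodule.span_singleton_le_iff_mem, Submodule.restrictScalars_mem] at hle
    rw [eq_span_of_mem hP1 h0 hle] at hP2
    exact (phi_span_eq_iff h0).1 hP2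
  · intro h
    refine ⟨hF.collinearOrbit hT hw hn, _, ⟨Submodule.span L {w},
      ⟨finrank_span_singleton h0, (phi_span_eq_iff h0).2 h⟩, rfl⟩, ?_⟩
    rw [Submodule.span_singleton_le_iff_mem, Submodule.restrictScalars_mem]
    exact Submodule.mem_span_singleton_self w

/-- `T²w` lies in the `K`-span of `w` and `Tw`, hence in their `L`-span. So the orbit of `Lw` is
either a single point or three collinear points. -/
theorem isIIColPoint_span_iff (hT : IsRegular T) (hF : IsFrame T a b ℓ π) {w : V} (hw : w ∈ π)
    (hn : T.toEquiv w ∉ K ∙ w) : IsIIColPoint T (K ∙ w) ↔ ¬ IsIColPoint T (K ∙ w) := by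
  have h0 : w ≠ 0 := by rintro rfl; simp at hn
  rw [hF.isIColPoint_span_iff hT hw hn]
  constructor
  · rintro ⟨-, α, ⟨P, ⟨hP1, hP2, -⟩, rfl⟩, hle⟩ h
    rw [Submodule.span_singleton_le_iff_mem, Submodule.restrictScalars_mem] at hle
    rw [eq_span_of_mem hP1 h0 hle] at hP2
    exact hP2 ((phi_span_eq_iff h0).2 h).symm
  · intro h
    refine ⟨hF.collinearOrbit hT hw hn, _, ⟨Submodule.span L {w},
      ⟨finrank_span_singleton h0, ?_⟩, rfl⟩, ?_⟩
    · rw [phi_span, phi_span]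
      refine collinear_orbit T.companion.toRingEquiv T.toEquiv T.map_smul hT.cube h0 ?_ ?_
      · intro hm
        obtain ⟨μ, hμ⟩ := Submodule.mem_span_singleton.1 hm
        exact h ⟨μ, hμ.symm⟩
      · exact span_pair_le_restrictScalars (K := K) w _ (hF.map_map_mem hw)
    · rw [Submodule.span_singleton_le_iff_mem, Submodule.restrictScalars_mem]
      exact Submodule.mem_span_singleton_self w

variable [FiniteDimensional K V]

omit [IsScalarTower K L V] [FiniteDimensional K V] in
theorem _root_.Bose.CollinearOrbit.mem_nonfixed {A W : Submodule K V} (h : CollinearOrbit T A)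
    (hA : A ≤ W) : A ∈ nonfixed T W := ⟨⟨h.1, h.2.1.symm⟩, hA⟩

theorem isIIColPoint_iff (hT : IsRegular T) (hF : IsFrame T a b ℓ π) {A : Submodule K V}
    (hA : A ≤ π) : IsIIColPoint T A ↔ A ∈ nonfixed T π ∧ ¬ IsIColPoint T A := by
  constructor
  · intro h
    have hm := h.1.mem_nonfixed hA
    obtain ⟨w, hw, hn, rfl⟩ := mem_nonfixed_iff.1 hm
    exact ⟨hm, (hF.isIIColPoint_span_iff hT hw hn).1 h⟩
  · rintro ⟨hm, h⟩
    obtain ⟨w, hw, hn, rfl⟩ := mem_nonfixed_iff.1 hm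
    exact (hF.isIIColPoint_span_iff hT hw hn).2 h

theorem ncard_IIColPoint [Finite V] (hT : IsRegular T) (hF : IsFrame T a b ℓ π) :
    {A | IsIColPoint T A ∧ A ≤ π}.ncard + {A | IsIIColPoint T A ∧ A ≤ π}.ncard
      = (nonfixed T π).ncard := by
  rw [← ncard_sep_add (nonfixed T π) (IsIColPoint T)]
  congr 2
  · ext A
    exact ⟨fun h => ⟨h.1.1.mem_nonfixed h.2, h.1⟩, fun h => ⟨h.2, h.1.2⟩⟩
  · ext A
    exact ⟨fun h => (hF.isIIColPoint_iff hT h.2).1 h.1,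
      fun h => ⟨(hF.isIIColPoint_iff hT h.1.2).2 h, h.1.2⟩⟩

variable {lam : L}

omit [FiniteDimensional K V] in
-- Put `z = Tw - bw ∈ ℓ`. If `w` is an `L`-eigenvector then `w = νz` with `ν ∈ L`, and applying `T`
-- gives `aθ(ν) = bν + 1`, whose solutions lie in `K + Kλ`. Finally `β ≠ 0` because `w` is not
-- fixed.
theorem exists_of_smul_eq (hT : IsRegular T) (h : GoodPair a b) (hl : IsShift T a b lam)
    (hF : IsFrame T a b ℓ π) {w : V} (hw : w ∈ π) (hn : T.toEquiv w ∉ K ∙ w) {μ : L}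
    (hμ : T.toEquiv w = μ • w) :
    ∃ z ∈ ℓ, z ≠ 0 ∧ ∃ α β : K, β ≠ 0 ∧ w = α • z + β • lam • z := by
  set z := T.toEquiv w - b • w with hz
  have hzl : z ∈ ℓ := hF.sub_mem w hw
  have hz0 : z ≠ 0 := by
    intro h
    exact hn (Submodule.mem_span_singleton.2 ⟨b, (sub_eq_zero.1 h).symm⟩)
  have hz1 : z = (μ - algebraMap K L b) • w := by rw [hz, hμ, sub_smul, algebraMap_smul]
  have hμb : μ - algebraMap K L b ≠ 0 := by
    intro h
    rw [h, zero_smul] at hz1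
    exact hz0 hz1
  set nu := (μ - algebraMap K L b)⁻¹ with hnu
  have hwz : w = nu • z := by rw [hz1, hnu, inv_smul_smul₀ hμb]
  have h1 := map_smul_eig (hF.le_eig hzl) nu
  rw [← hwz] at h1
  have h2 : (algebraMap K L a * T.companion nu) • z = (algebraMap K L b * nu + 1) • z := by
    rw [mul_comm, mul_smul, algebraMap_smul, ← h1, add_smul, one_smul, mul_smul, ← hwz,
      algebraMap_smul, hz]
    abel
  obtain ⟨α, β, hαβ⟩ := hl.exists_eq hT h (smul_left_injective L hz0 h2)
  have hw2 : w = α • z + β • lam • z := by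
    rw [hwz, hαβ, add_smul, mul_smul, algebraMap_smul, algebraMap_smul]
  refine ⟨z, hzl, hz0, α, β, ?_, hw2⟩
  rintro rfl
  rw [zero_smul, add_zero] at hw2
  apply hn
  have : w ∈ eig T a := hw2 ▸ (eig T a).smul_mem α (hF.le_eig hzl)
  exact Submodule.mem_span_singleton.2 ⟨a, (mem_eig.1 this).symm⟩

omit [FiniteDimensional K V] in
theorem smul_notMem (hT : IsRegular T) (h : GoodPair a b) (hl : IsShift T a b lam)
    (hF : IsFrame T a b ℓ π) {z : V} (hz : z ∈ ℓ) (h0 : z ≠ 0) : lam • z ∉ ℓ := fun hm =>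
  h0 (hl.eq_zero_of_smul_mem hT h.ne_zero (hF.le_eig hz) (hF.le_eig hm))

/-- In `π = ℓ + ⟨λz⟩` one has `λz' = u + kλz`, so `λ(z' - kz) = u ∈ eig T a`, forcing `z' = kz`.
This makes the fixed-I-line of `π` unique. -/
theorem mem_span_of_smul_mem (hT : IsRegular T) (h : GoodPair a b) (hl : IsShift T a b lam)
    (hF : IsFrame T a b ℓ π) {z z' : V} (hz : z ∈ ℓ) (h0 : z ≠ 0) (hz' : z' ∈ ℓ)
    (hm : lam • z ∈ π) (hm' : lam • z' ∈ π) : z' ∈ K ∙ z := by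
  rw [← hF.eq_sup hm (hF.smul_notMem hT h hl hz h0)] at hm'
  obtain ⟨u, hu, y, hy, he⟩ := Submodule.mem_sup.1 hm'
  obtain ⟨k, rfl⟩ := Submodule.mem_span_singleton.1 hy
  have h1 : lam • (z' - k • z) = u := by
    rw [smul_sub, ← he, smul_comm lam k]; abel
  have h2 := hl.eq_zero_of_smul_mem hT h.ne_zero
    (hF.le_eig (ℓ.sub_mem hz' (ℓ.smul_mem k hz))) (h1 ▸ hF.le_eig hu)
  exact Submodule.mem_span_singleton.2 ⟨k, (sub_eq_zero.1 h2).symm⟩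

section

variable (hT : IsRegular T) (h : GoodPair a b) (hl : IsShift T a b lam)
    (hF : IsFrame T a b ℓ π) {z : V} (hz : z ∈ ℓ) (h0 : z ≠ 0) (hm : lam • z ∈ π)

omit [FiniteDimensional K V] in
include hl hF hz in
theorem map_sub_mem_span {w : V} (hw : w ∈ (K ∙ z) ⊔ (K ∙ lam • z)) :
    T.toEquiv w - b • w ∈ K ∙ z := by
  obtain ⟨x, hx, y, hy, rfl⟩ := Submodule.mem_sup.1 hw
  obtain ⟨c, rfl⟩ := Submodule.mem_span_singleton.1 hx
  obtain ⟨d, rfl⟩ := Submodule.mem_span_singleton.1 hy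
  have hze := hF.le_eig hz
  rw [map_add, map_smul, map_smul, hl.map_smul hze, mem_eig.1 hze]
  exact Submodule.mem_span_singleton.2 ⟨c * (a - b) + d, by module⟩

include hT h hl hF hz h0 hm

theorem typeILine_mem_fixedLines : (K ∙ z) ⊔ (K ∙ lam • z) ∈ fixedLines T ℓ π := by
  have hn := hF.smul_notMem hT h hl hz h0
  have hzl : (K ∙ z) ≤ ℓ := by simpa using hz
  refine ⟨finrank_sup_span_singleton (fun h => hn (hzl h)) 1 (finrank_span_singleton h0), ?_, ?_,
    sup_le (hzl.trans hF.le) (by simpa using hm)⟩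
  · rw [sigma_eq_iff]
    intro w hw
    have := add_mem (Submodule.mem_sup_left (hF.map_sub_mem_span hl hz hw))
      (Submodule.smul_mem _ b hw)
    simpa using this
  · intro he
    exact hn (he ▸ Submodule.mem_sup_right (Submodule.mem_span_singleton_self _))

/-- A type I point of `π` comes from some `z'` with `λz' ∈ π`, and `z'` is a multiple of `z`.
Conversely `⟨z, λz⟩` is invariant and lies in the single spread plane `Lz`. -/
theorem isIColPoint_iff {A : Submodule K V} (hA : A ≤ π) :
    IsIColPoint T A ↔ A ∈ nonfixed T ((K ∙ z) ⊔ (K ∙ lam • z)) := by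
  constructor
  · intro hI
    have hnf := hI.1.mem_nonfixed hA
    obtain ⟨w, hw, hn, rfl⟩ := mem_nonfixed_iff.1 hnf
    obtain ⟨μ, hμ⟩ := (hF.isIColPoint_span_iff hT hw hn).1 hI
    obtain ⟨z', hz', h0', α, β, hβ, rfl⟩ := hF.exists_of_smul_eq hT h hl hw hn hμ
    refine ⟨hnf.1, ?_⟩
    have h1 : lam • z' ∈ π := by
      have := π.smul_mem β⁻¹ (π.sub_mem hw (π.smul_mem α (hF.le hz')))
      rwa [add_sub_cancel_left, inv_smul_smul₀ hβ] at this
    obtain ⟨k, rfl⟩ := Submodule.mem_span_singleton.1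
      (hF.mem_span_of_smul_mem hT h hl hz h0 hz' hm h1)
    rw [Submodule.span_singleton_le_iff_mem, smul_comm lam k]
    exact Submodule.add_mem_sup
      (Submodule.smul_mem _ _ (Submodule.smul_mem _ _ (Submodule.mem_span_singleton_self _)))
      (Submodule.smul_mem _ _ (Submodule.smul_mem _ _ (Submodule.mem_span_singleton_self _)))
  · intro hnf
    obtain ⟨w, hw, hn, rfl⟩ := mem_nonfixed_iff.1 hnf
    rw [Submodule.span_singleton_le_iff_mem] at hA
    rw [hF.isIColPoint_span_iff hT hA hn]
    have hz1 : (K ∙ z) ⊔ (K ∙ lam • z) ≤ (Submodule.span L {z}).restrictScalars K := by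
      refine sup_le ?_ ?_
      · rw [Submodule.span_singleton_le_iff_mem]
        exact Submodule.mem_span_singleton_self z
      · rw [Submodule.span_singleton_le_iff_mem]
        exact Submodule.smul_mem _ _ (Submodule.mem_span_singleton_self z)
    have h1 : T.toEquiv w ∈ Submodule.span L {z} := hz1 ((sigma_eq_iff T _).1
      (hF.typeILine_mem_fixedLines hT h hl hz h0 hm).2.1 w hw)
    have hw0 : w ≠ 0 := by rintro rfl; simp at hn
    rw [← span_singleton_eq_of_mem hw0 (hz1 hw)] at h1
    obtain ⟨μ, hμ⟩ := Submodule.mem_span_singleton.1 h1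
    exact ⟨μ, hμ.symm⟩

theorem isFixedILine_iff {m : Submodule K V} (hmπ : m ≤ π) :
    IsFixedILine T m ↔ m = (K ∙ z) ⊔ (K ∙ lam • z) := by
  have hz2 := hF.typeILine_mem_fixedLines hT h hl hz h0 hm
  constructor
  · rintro ⟨h1, h2, A, hA, hI⟩
    have hnf := (hF.isIColPoint_iff hT h hl hz h0 hm (hA.trans hmπ)).1 hI
    obtain ⟨w, hw, hn, rfl⟩ := mem_nonfixed_iff.1 hnf
    rw [← eq_span_pair hn h1 h2 (by simpa using hA), ← eq_span_pair hn hz2.1 hz2.2.1 hw]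
  · rintro rfl
    refine ⟨hz2.1, hz2.2.1, K ∙ lam • z, le_sup_right,
      (hF.isIColPoint_iff hT h hl hz h0 hm (le_sup_right.trans hmπ)).2 ?_⟩
    refine mem_nonfixed_iff.2 ⟨lam • z, Submodule.mem_sup_right
      (Submodule.mem_span_singleton_self _), ?_, rfl⟩
    have hze := hF.le_eig hz
    intro hmem
    obtain ⟨k, hk⟩ := Submodule.mem_span_singleton.1 hmem
    rw [hl.map_smul hze] at hk
    have h3 : lam • ((k - b) • z) = z := by
      rw [smul_comm]
      linear_combination (norm := module) hk
    have h4 := hl.eq_zero_of_smul_mem hT h.ne_zero ((eig T a).smul_mem (k - b) hze)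
      (h3.symm ▸ hze)
    rw [h4, smul_zero] at h3
    exact h0 h3.symm

end

/-- A frame plane contains a fixed-I-line iff it meets `lam • ℓ`. -/
theorem exists_fixedILine_iff (hT : IsRegular T) (h : GoodPair a b) (hl : IsShift T a b lam)
    (hF : IsFrame T a b ℓ π) :
    (∃ m ≤ π, IsFixedILine T m) ↔ ∃ z ∈ ℓ, z ≠ 0 ∧ lam • z ∈ π := by
  constructor
  · rintro ⟨m, hm, -, -, A, hA, hI⟩
    have hnf := hI.1.mem_nonfixed (hA.trans hm)
    obtain ⟨w, hw, hn, rfl⟩ := mem_nonfixed_iff.1 hnf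
    obtain ⟨μ, hμ⟩ := (hF.isIColPoint_span_iff hT hw hn).1 hI
    obtain ⟨z, hz, h0, α, β, hβ, rfl⟩ := hF.exists_of_smul_eq hT h hl hw hn hμ
    refine ⟨z, hz, h0, ?_⟩
    have := π.smul_mem β⁻¹ (π.sub_mem hw (π.smul_mem α (hF.le hz)))
    rwa [add_sub_cancel_left, inv_smul_smul₀ hβ] at this
  · rintro ⟨z, hz, h0, hm⟩
    have := hF.typeILine_mem_fixedLines hT h hl hz h0 hm
    exact ⟨_, this.2.2.2, (hF.isFixedILine_iff hT h hl hz h0 hm this.2.2.2).2 rfl⟩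

theorem isFixedIILine_iff (hT : IsRegular T) (h : GoodPair a b)
    (hF : IsFrame T a b ℓ π) {m : Submodule K V} (hmπ : m ≤ π) :
    IsFixedIILine T m ↔ m ∈ fixedLines T ℓ π ∧ ¬ IsFixedILine T m := by
  constructor
  · rintro ⟨h1, h2, A, hA, hII⟩
    have hnf := (hF.isIIColPoint_iff hT (hA.trans hmπ)).1 hII
    refine ⟨hF.mem_fixedLines_of_nonfixed h1 h2 hmπ ⟨hnf.1.1, hA⟩, fun hI => hnf.2 ?_⟩
    obtain ⟨lam, hl⟩ := exists_isShift hT h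
    obtain ⟨z, hz, h0, hm⟩ := (hF.exists_fixedILine_iff hT h hl).1 ⟨m, hmπ, hI⟩
    have hmz := (hF.isFixedILine_iff hT h hl hz h0 hm hmπ).1 hI
    exact (hF.isIColPoint_iff hT h hl hz h0 hm (hA.trans hmπ)).2 ⟨hnf.1.1, hmz ▸ hA⟩
  · rintro ⟨hm, hI⟩
    refine ⟨hm.1, hm.2.1, ?_⟩
    have hp : ¬ PtwiseFixed T m := by
      rw [ptwiseFixed_iff]
      rintro ⟨c, hc⟩
      exact hm.2.2.1 (hF.eq_of_ptwiseFixed hm.1 hmπ hc)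
    simp only [PtwiseFixed, not_forall] at hp
    obtain ⟨A, h1, h2, h3⟩ := hp
    exact ⟨A, h2, (hF.isIIColPoint_iff hT (h2.trans hmπ)).2
      ⟨⟨⟨h1, h3⟩, h2.trans hmπ⟩, fun hc => hI ⟨hm.1, hm.2.1, A, h2, hc⟩⟩⟩

theorem ncard_fixedIILine [Finite V] (hT : IsRegular T) (h : GoodPair a b)
    (hF : IsFrame T a b ℓ π) :
    {m | IsFixedILine T m ∧ m ≤ π}.ncard + {m | IsFixedIILine T m ∧ m ≤ π}.ncard
      = (fixedLines T ℓ π).ncard := by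
  rw [← ncard_sep_add (fixedLines T ℓ π) (IsFixedILine T)]
  congr 2
  · ext m
    refine ⟨fun ⟨hI, hle⟩ => ⟨?_, hI⟩, fun hm => ⟨hm.2, hm.1.2.2.2⟩⟩
    obtain ⟨h1, h2, A, hA, hc⟩ := hI
    exact hF.mem_fixedLines_of_nonfixed h1 h2 hle (hc.1.mem_nonfixed hA)
  · ext m
    exact ⟨fun hm => (hF.isFixedIILine_iff hT h hm.2).1 hm.1,
      fun hm => ⟨(hF.isFixedIILine_iff hT h hm.1.2.2.2).2 hm, hm.1.2.2.2⟩⟩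

theorem ncard_of_fixedILine [Finite K] [Finite V] (hT : IsRegular T) (h : GoodPair a b)
    (hF : IsFrame T a b ℓ π) (hI : ∃ m ≤ π, IsFixedILine T m) :
    {A | IsIColPoint T A ∧ A ≤ π}.ncard + eps a b = Nat.card K ∧
      {m | IsFixedILine T m ∧ m ≤ π}.ncard = 1 := by
  obtain ⟨lam, hl⟩ := exists_isShift hT h
  obtain ⟨z, hz, h0, hm⟩ := (hF.exists_fixedILine_iff hT h hl).1 hI
  have hz2 := hF.typeILine_mem_fixedLines hT h hl hz h0 hm
  constructor
  · rw [← hF.ncard_nonfixed_line hz2]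
    congr 2
    ext A
    exact ⟨fun hA => (hF.isIColPoint_iff hT h hl hz h0 hm hA.2).1 hA.1, fun hA =>
      have hle := hA.2.trans hz2.2.2.2
      ⟨(hF.isIColPoint_iff hT h hl hz h0 hm hle).2 hA, hle⟩⟩
  · rw [Set.ncard_eq_one]
    refine ⟨(K ∙ z) ⊔ (K ∙ lam • z), ?_⟩
    ext m
    exact ⟨fun hx => (hF.isFixedILine_iff hT h hl hz h0 hm hx.2).1 hx.1, fun hx =>
      have hle : m ≤ π := hx.le.trans hz2.2.2.2
      ⟨(hF.isFixedILine_iff hT h hl hz h0 hm hle).2 hx, hle⟩⟩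

theorem ncard_of_not_fixedILine (hI : ¬ ∃ m ≤ π, IsFixedILine T m)
    (hF : IsFrame T a b ℓ π) :
    {A | IsIColPoint T A ∧ A ≤ π}.ncard = 0 ∧ {m | IsFixedILine T m ∧ m ≤ π}.ncard = 0 := by
  constructor
  · convert Set.ncard_empty (Submodule K V)
    rw [Set.eq_empty_iff_forall_notMem]
    rintro A ⟨hc, hA⟩
    obtain ⟨w, hw, hn, rfl⟩ := mem_nonfixed_iff.1 (hc.1.mem_nonfixed hA)
    have h0 : w ≠ 0 := by rintro rfl; simp at hn
    exact hI ⟨(K ∙ w) ⊔ (K ∙ T.toEquiv w),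
      sup_le (by simpa using hw) (by simpa using hF.map_mem hw),
      finrank_sup_span_singleton hn 1 (finrank_span_singleton h0), hF.sigma_span_pair hw,
      K ∙ w, le_sup_left, hc⟩
  · convert Set.ncard_empty (Submodule K V)
    rw [Set.eq_empty_iff_forall_notMem]
    rintro m ⟨hc, hm⟩
    exact hI ⟨m, hm, hc⟩

/-- The `L`-span of `ℓ` is generated by eigenvectors, so it is a type I line; it contains `λz`,
hence all of `π = ℓ + ⟨λz⟩`. -/
theorem exists_HI5Space (hT : IsRegular T) (h : GoodPair a b)
    (hF : IsFrame T a b ℓ π) (hI : ∃ m ≤ π, IsFixedILine T m) :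
    ∃ S, IsHI5Space T S ∧ π ≤ S := by
  obtain ⟨lam, hl⟩ := exists_isShift hT h
  obtain ⟨z, hz, h0, hm⟩ := (hF.exists_fixedILine_iff hT h hl).1 hI
  obtain ⟨y, hy, hyz, he⟩ := exists_eq_sup_span (K := K) (E := K ∙ z) (m := ℓ) (d := 1)
    (by simpa using hz) (finrank_span_singleton h0) hF.finrank_line
  have hzmem : z ∈ Submodule.span L {z, y} := Submodule.subset_span (by simp)
  have hle : ℓ ≤ (Submodule.span L {z, y}).restrictScalars K := by
    rw [he]; exact span_pair_le_restrictScalars z y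
  refine ⟨_, ⟨Submodule.span L {z, y}, ⟨?_, ?_⟩, rfl⟩, ?_⟩
  · rw [← Matrix.range_cons_cons_empty z y ![], finrank_span_eq_card, Fintype.card_fin]
    rw [LinearIndependent.pair_iff' h0]
    -- The ratio of two `a`-eigenvectors lies in `K`, so `K`-independence of `z` and `y` gives
    -- `L`-independence.
    rintro c rfl
    obtain ⟨k, rfl⟩ := exists_of_smul_mem_eig hT h.ne_zero (hF.le_eig hz) h0 (hF.le_eig hy)
    exact hyz (Submodule.mem_span_singleton.2 ⟨k, (algebraMap_smul L k z).symm⟩)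
  · ext w
    have haL : algebraMap K L a ≠ 0 := by simpa using h.ne_zero
    have hz1 := mem_eig.1 (hF.le_eig hz)
    have hy1 := mem_eig.1 (hF.le_eig hy)
    constructor
    · rintro ⟨x, hx, rfl⟩
      obtain ⟨c, d, rfl⟩ := Submodule.mem_span_pair.1 hx
      refine Submodule.mem_span_pair.2 ⟨T.companion c * algebraMap K L a,
        T.companion d * algebraMap K L a, ?_⟩
      rw [map_add, T.map_smul, T.map_smul, hz1, hy1, mul_smul, mul_smul, algebraMap_smul,
        algebraMap_smul]
    · intro hw
      obtain ⟨c, d, rfl⟩ := Submodule.mem_span_pair.1 hw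
      refine ⟨T.companion.symm (c * (algebraMap K L a)⁻¹) • z
        + T.companion.symm (d * (algebraMap K L a)⁻¹) • y, ?_, ?_⟩
      · exact Submodule.mem_span_pair.2 ⟨_, _, rfl⟩
      · rw [map_add, T.map_smul, T.map_smul, hz1, hy1, AlgEquiv.apply_symm_apply,
          AlgEquiv.apply_symm_apply, ← algebraMap_smul L a z, ← algebraMap_smul L a y, smul_smul,
          smul_smul, inv_mul_cancel_right₀ haL, inv_mul_cancel_right₀ haL]
  · rw [← hF.eq_sup hm (hF.smul_notMem hT h hl hz h0)]
    refine sup_le hle ?_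
    rw [Submodule.span_singleton_le_iff_mem, Submodule.restrictScalars_mem]
    exact Submodule.smul_mem _ lam hzmem

end IsFrame

end

/-! ### Counting the frame planes on a given line -/

section

variable {K L V : Type*} [Field K] [Field L] [Algebra K L] [AddCommGroup V] [Module K V]
  [Module L V] [IsScalarTower K L V]
  {T : SemilinearAut K L V} {a b : K} {ℓ : Submodule K V} {lam : L}

theorem IsShift.add_notMem (hT : IsRegular T) (h : GoodPair a b) (hl : IsShift T a b lam)
    {x y : V} (hx : x ∈ eig T a) (hy : y ∈ eig T a) (hy0 : y ≠ 0) : x + lam • y ∉ eig T a :=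
  fun hm => hy0 (hl.eq_zero_of_smul_mem hT h.ne_zero hy (by simpa using sub_mem hm hx))

theorem IsShift.eq_of_add_eq (hT : IsRegular T) (h : GoodPair a b) (hl : IsShift T a b lam)
    {x y x' y' : V} (hx : x ∈ eig T a) (hy : y ∈ eig T a) (hx' : x' ∈ eig T a)
    (hy' : y' ∈ eig T a) (he : x + lam • y = x' + lam • y') : x = x' ∧ y = y' := by
  have h1 : lam • (y - y') = x' - x := by
    rw [smul_sub, sub_eq_sub_iff_add_eq_add, add_comm, he, add_comm]
  have h2 := hl.eq_zero_of_smul_mem hT h.ne_zero (sub_mem hy hy') (h1 ▸ sub_mem hx' hx)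
  have h3 := sub_eq_zero.1 h2
  subst h3
  exact ⟨add_right_cancel he, rfl⟩

theorem IsShift.map_add_sub (hl : IsShift T a b lam) {x y : V} (hx : x ∈ eig T a)
    (hy : y ∈ eig T a) :
    T.toEquiv (x + lam • y) - b • (x + lam • y) = (a - b) • x + y := by
  rw [map_add, hl.map_smul hy, mem_eig.1 hx]
  module

/-- `(T - b)(x + λy) = (a - b)x + y`, so `hxy` is the condition that `T` acts as `b` modulo `ℓ`; `y
≠ 0` keeps the plane from being pointwise fixed. -/
theorem IsShift.isFrame [FiniteDimensional K V] (hT : IsRegular T) (h : GoodPair a b)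
    (hl : IsShift T a b lam) (hle : ℓ ≤ eig T a) (hd : finrank K ℓ = 2) {x y : V}
    (hx : x ∈ eig T a) (hy : y ∈ eig T a) (hy0 : y ≠ 0) (hxy : (a - b) • x + y ∈ ℓ) :
    IsFrame T a b ℓ (ℓ ⊔ K ∙ (x + lam • y)) := by
  have hn := hl.add_notMem hT h hx hy hy0
  refine ⟨hle, hd, le_sup_left, finrank_sup_span_singleton (fun hm => hn (hle hm)) 2 hd, ?_,
    fun hm => hn (hm (Submodule.mem_sup_right (Submodule.mem_span_singleton_self _)))⟩
  intro v hv
  obtain ⟨u, hu, w, hw, rfl⟩ := Submodule.mem_sup.1 hv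
  obtain ⟨c, rfl⟩ := Submodule.mem_span_singleton.1 hw
  have h1 : T.toEquiv (u + c • (x + lam • y)) - b • (u + c • (x + lam • y))
      = (a - b) • u + c • (T.toEquiv (x + lam • y) - b • (x + lam • y)) := by
    rw [map_add, _root_.map_smul, mem_eig.1 (hle hu)]
    module
  rw [h1, hl.map_add_sub hx hy]
  exact add_mem (ℓ.smul_mem _ hu) (ℓ.smul_mem _ hxy)

theorem IsFrame.exists_decomp (h : GoodPair a b)
    (hl : IsShift T a b lam) {π : Submodule K V} (hF : IsFrame T a b ℓ π) {v : V} (hv : v ∈ π) :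
    ∃ x ∈ eig T a, ∃ y ∈ eig T a, v = x + lam • y ∧ (a - b) • x + y ∈ ℓ := by
  obtain ⟨x, hx, y, hy, rfl⟩ := hl.exists_decomp h (hF.map_sub_eq' hv)
  exact ⟨x, hx, y, hy, rfl, by rw [← hl.map_add_sub hx hy]; exact hF.sub_mem _ hv⟩

/-- The planes in question are `ℓ + ⟨λz⟩`, one for each of the `q + 1` points `⟨z⟩` of `ℓ`. -/
theorem ncard_frames_fixedILine [Finite K] [Finite V] (hT : IsRegular T) (h : GoodPair a b)
    (hle : ℓ ≤ eig T a) (hd : finrank K ℓ = 2) :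
    {π | IsFrame T a b ℓ π ∧ ∃ m ≤ π, IsFixedILine T m}.ncard = Nat.card K + 1 := by
  obtain ⟨lam, hl⟩ := exists_isShift hT h
  have hpts := ncard_points_le hd
  simp only [Finset.sum_range_succ, Finset.sum_range_zero, pow_zero, pow_one, zero_add] at hpts
  rw [add_comm, ← hpts]
  have hmap : ∀ z : V, (K ∙ z).map (DistribSMul.toLinearMap K V lam) = K ∙ lam • z := by
    intro z
    rw [Submodule.map_span, Set.image_singleton]; rfl
  symm
  refine Set.ncard_congr (fun A _ => ℓ ⊔ A.map (DistribSMul.toLinearMap K V lam)) ?_ ?_ ?_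
  · rintro A ⟨h1, h2⟩
    obtain ⟨z, h0, rfl⟩ := finrank_eq_one_iff_exists_span.1 h1
    rw [Submodule.span_singleton_le_iff_mem] at h2
    simp only [hmap]
    have hF := hl.isFrame hT h hle hd (zero_mem _) (hle h2) h0 (by simpa using h2)
    rw [zero_add] at hF
    exact ⟨hF, (hF.exists_fixedILine_iff hT h hl).2 ⟨z, h2, h0,
      Submodule.mem_sup_right (Submodule.mem_span_singleton_self _)⟩⟩
  · rintro A B ⟨hA1, hA2⟩ ⟨hB1, hB2⟩ he
    obtain ⟨z, h0, rfl⟩ := finrank_eq_one_iff_exists_span.1 hA1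
    obtain ⟨z', h0', rfl⟩ := finrank_eq_one_iff_exists_span.1 hB1
    rw [Submodule.span_singleton_le_iff_mem] at hA2 hB2
    simp only [hmap] at he
    have hF := hl.isFrame hT h hle hd (zero_mem _) (hle hA2) h0 (by simpa using hA2)
    rw [zero_add] at hF
    exact (span_singleton_eq_of_mem h0' (hF.mem_span_of_smul_mem hT h hl hA2 h0 hB2
      (Submodule.mem_sup_right (Submodule.mem_span_singleton_self _))
      (he ▸ Submodule.mem_sup_right (Submodule.mem_span_singleton_self _)))).symm
  · rintro π ⟨hF, hI⟩
    obtain ⟨z, hz, h0, hm⟩ := (hF.exists_fixedILine_iff hT h hl).1 hI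
    refine ⟨K ∙ z, ⟨finrank_span_singleton h0, by simpa using hz⟩, ?_⟩
    rw [hmap]
    exact hF.eq_sup hm (hF.smul_notMem hT h hl hz h0)

/-- Fix `x ∈ eig T a` outside `ℓ`. Scaling and adding elements of `ℓ` normalise a generator of `π`
over `ℓ` to `x + λy`; the frame condition then reads `y = u - (a - b)x` with `u ∈ ℓ`, and `u`
parametrises the planes. -/
theorem ncard_frames_not_fixedILine [Finite K] [Finite V] (hT : IsRegular T) (h : GoodPair a b)
    (hle : ℓ ≤ eig T a) (hd : finrank K ℓ = 2) :
    {π | IsFrame T a b ℓ π ∧ ¬ ∃ m ≤ π, IsFixedILine T m}.ncard + 1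
      = Nat.card K ^ 2 + eps a b := by
  obtain ⟨lam, hl⟩ := exists_isShift hT h
  obtain ⟨x, hx, hxl, hsup⟩ := exists_eq_sup_span hle hd (hT.finrank_eig a h.1)
  -- The excluded value corresponds to `y = 0`. It lies in `ℓ` only if `a = b`, where it is `0`,
  -- since `x ∉ ℓ`.
  have hcount : {u | u ∈ ℓ ∧ u ≠ (a - b) • x}.ncard + 1 = Nat.card K ^ 2 + eps a b := by
    have h1 := ncard_sep_add (ℓ : Set V) (fun u => u ≠ (a - b) • x)
    have h2 : {u | u ∈ (ℓ : Set V) ∧ ¬ u ≠ (a - b) • x}.ncard + eps a b = 1 := by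
      unfold eps
      split_ifs with hab
      · subst hab
        rw [add_zero, Set.ncard_eq_one]
        refine ⟨0, ?_⟩
        ext u
        simp only [SetLike.mem_coe, sub_self, zero_smul, ne_eq, not_not, Set.mem_ofPred_eq,
          Set.mem_singleton_iff, and_iff_right_iff_imp]
        rintro rfl
        exact zero_mem _
      · rw [Nat.add_eq_right, Set.ncard_eq_zero, Set.eq_empty_iff_forall_notMem]
        rintro u ⟨hu, he⟩
        rw [not_not] at he
        apply hxl
        have := ℓ.smul_mem (a - b)⁻¹ hu
        rwa [he, inv_smul_smul₀ (sub_ne_zero.2 hab)] at this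
    have h3 : (ℓ : Set V).ncard = Nat.card K ^ 2 := by
      rw [← hd, ← natCard_submodule]; rfl
    rw [h3] at h1
    have h4 : {u | u ∈ (ℓ : Set V) ∧ u ≠ (a - b) • x} = {u | u ∈ ℓ ∧ u ≠ (a - b) • x} := rfl
    rw [h4] at h1
    omega
  rw [← hcount]
  congr 1
  have hy : ∀ u ∈ ℓ, u - (a - b) • x ∈ eig T a := fun u hu =>
    sub_mem (hle hu) ((eig T a).smul_mem _ hx)
  have hfr : ∀ u ∈ ℓ, u ≠ (a - b) • x →
      IsFrame T a b ℓ (ℓ ⊔ K ∙ (x + lam • (u - (a - b) • x))) := fun u hu hne =>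
    hl.isFrame hT h hle hd hx (hy u hu) (sub_ne_zero.2 hne) (by simpa using hu)
  have hself : ∀ v : V, v ∈ ℓ ⊔ K ∙ v := fun v =>
    Submodule.mem_sup_right (Submodule.mem_span_singleton_self v)
  -- Comparing components in `eig T a ⊕ λ eig T a`: a multiple `c` of the generator contributes `cx`
  -- to the first one, and `x ∉ ℓ` forces `c = 0`.
  have hnot : ∀ u ∈ ℓ, u ≠ (a - b) • x → ∀ z ∈ ℓ, z ≠ 0 →
      lam • z ∉ ℓ ⊔ K ∙ (x + lam • (u - (a - b) • x)) := by
    intro u hu hne z hz h0 hm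
    obtain ⟨w, hw, y, hy', he⟩ := Submodule.mem_sup.1 hm
    obtain ⟨c, rfl⟩ := Submodule.mem_span_singleton.1 hy'
    have he' : (w + c • x) + lam • (c • (u - (a - b) • x)) = 0 + lam • z := by
      rw [zero_add, ← he, smul_comm lam c, smul_add]; abel
    obtain ⟨e1, e2⟩ := hl.eq_of_add_eq hT h
      (add_mem (hle hw) ((eig T a).smul_mem c hx)) ((eig T a).smul_mem c (hy u hu))
      (zero_mem _) (hle hz) he'
    by_cases hc : c = 0
    · subst hc
      exact h0 (by rw [← e2, zero_smul])
    · apply hxl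
      have : c • x ∈ ℓ := by
        rw [eq_neg_of_add_eq_zero_right e1]
        exact neg_mem hw
      have := ℓ.smul_mem c⁻¹ this
      rwa [inv_smul_smul₀ hc] at this
  symm
  refine Set.ncard_congr (fun u _ => ℓ ⊔ K ∙ (x + lam • (u - (a - b) • x))) ?_ ?_ ?_
  · rintro u ⟨hu, hne⟩
    refine ⟨hfr u hu hne, ?_⟩
    rw [(hfr u hu hne).exists_fixedILine_iff hT h hl]
    rintro ⟨z, hz, h0, hm⟩
    exact hnot u hu hne z hz h0 hm
  · rintro u u' ⟨hu, hne⟩ ⟨hu', hne'⟩ he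
    -- Two parameters giving the same plane would put `λ(u' - u)` in it, contradicting `hnot`.
    by_contra huu
    refine hnot u hu hne (u' - u) (ℓ.sub_mem hu' hu) (sub_ne_zero.2 (Ne.symm huu)) ?_
    have h1 := hself (x + lam • (u' - (a - b) • x))
    rw [← he] at h1
    have h2 := sub_mem h1 (hself (x + lam • (u - (a - b) • x)))
    rw [add_sub_add_left_eq_sub, ← smul_sub, sub_sub_sub_cancel_right] at h2
    exact h2
  · rintro π ⟨hF, hI⟩
    obtain ⟨v, hv, hvl⟩ := hF.exists_notMem
    obtain ⟨x', hx', y, hy', rfl, hxy⟩ := hF.exists_decomp h hl hv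
    rw [hsup] at hx'
    obtain ⟨w, hw, cx, hcx, rfl⟩ := Submodule.mem_sup.1 hx'
    obtain ⟨c, rfl⟩ := Submodule.mem_span_singleton.1 hcx
    -- If the first component lay in `ℓ`, then `y ∈ ℓ` and `λy ∈ π`, so `π` would contain a
    -- fixed-I-line.
    have hc : c ≠ 0 := by
      rintro rfl
      simp only [zero_smul, add_zero] at hv hvl hxy
      apply hI
      rw [hF.exists_fixedILine_iff hT h hl]
      refine ⟨y, by simpa using sub_mem hxy (ℓ.smul_mem (a - b) hw), ?_, ?_⟩
      · rintro rfl
        exact hvl (by simpa using hw)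
      · simpa using sub_mem hv (hF.le hw)
    have hu : (a - b) • x + c⁻¹ • y ∈ ℓ := by
      have h1 := ℓ.smul_mem c⁻¹ (sub_mem hxy (ℓ.smul_mem (a - b) hw))
      have h2 : c⁻¹ • ((a - b) • (w + c • x) + y - (a - b) • w) = (a - b) • x + c⁻¹ • y := by
        rw [show (a - b) • (w + c • x) + y - (a - b) • w = c • (a - b) • x + y by module, smul_add,
          inv_smul_smul₀ hc]
      rwa [h2] at h1
    have hmem : x + lam • (c⁻¹ • y) ∈ π := by
      have h1 := π.smul_mem c⁻¹ (sub_mem hv (hF.le hw))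
      have h2 : c⁻¹ • (w + c • x + lam • y - w) = x + lam • (c⁻¹ • y) := by
        rw [show w + c • x + lam • y - w = c • x + lam • y by abel, smul_add, inv_smul_smul₀ hc,
          smul_comm lam]
      rwa [h2] at h1
    have hnm : x + lam • (c⁻¹ • y) ∉ ℓ := by
      intro hm
      apply hvl
      have h1 := add_mem hw (ℓ.smul_mem c hm)
      rwa [smul_add, smul_comm lam, smul_inv_smul₀ hc, ← add_assoc] at h1
    refine ⟨(a - b) • x + c⁻¹ • y, ⟨hu, ?_⟩, ?_⟩
    · intro he
      have hy0 : c⁻¹ • y = 0 := by simpa using he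
      rw [hy0, smul_zero, add_zero] at hmem hnm
      have h3 : y = 0 := by simpa [hc] using hy0
      subst h3
      rw [hy0, add_zero] at hu
      have hab : a = b := by
        by_contra hab
        apply hxl
        have := ℓ.smul_mem (a - b)⁻¹ hu
        rwa [inv_smul_smul₀ (sub_ne_zero.2 hab)] at this
      apply hF.not_le
      rw [← hF.eq_sup hmem hnm]
      exact sup_le hle (by simpa using hx)
    · simp only [add_sub_cancel_left]
      exact hF.eq_sup hmem hnm

/-- The pairs `((a, b), ℓ)` that can underlie an h-plane. -/
def frameIndex (T : SemilinearAut K L V) : Set ((K × K) × Submodule K V) :=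
  {p | GoodPair p.1.1 p.1.2 ∧ finrank K p.2 = 2 ∧ p.2 ≤ eig T p.1.1}

omit [IsScalarTower K L V] in
theorem ncard_frameIndex [Finite K] [Finite V] (hT : IsRegular T) :
    (frameIndex T).ncard
      = {p : K × K | GoodPair p.1 p.2}.ncard * (Nat.card K ^ 2 + Nat.card K + 1) := by
  refine ncard_eq_mul_of_fibers (fun p s => p.1 = s) _ ?_ ?_
  · rintro ⟨s, ℓ⟩ ⟨h, -, -⟩
    exact ⟨s, ⟨h, rfl⟩, fun t ht => ht.2.symm⟩
  · rintro s hs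
    have h1 := ncard_lines_le (hT.finrank_eig s.1 hs.1)
    simp only [Finset.sum_range_succ, Finset.sum_range_zero, pow_zero, pow_one, zero_add] at h1
    rw [show Nat.card K ^ 2 + Nat.card K + 1 = 1 + Nat.card K + Nat.card K ^ 2 by ring, ← h1]
    refine Set.ncard_congr (fun p _ => p.2) ?_ ?_ ?_
    · rintro ⟨s', ℓ⟩ ⟨⟨-, h2, h3⟩, rfl⟩
      exact ⟨h2, h3⟩
    · rintro p p' ⟨-, h2⟩ ⟨-, h3⟩ h4
      exact Prod.ext (h2.trans h3.symm) h4
    · rintro ℓ ⟨h2, h3⟩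
      exact ⟨(s, ℓ), ⟨⟨hs, h2, h3⟩, rfl⟩, rfl⟩

/-- Each h-plane has exactly one frame, so the h-planes fibre over `frameIndex T`. -/
theorem ncard_hPlanes_sep [Finite K] [Finite V] (hT : IsRegular T) {ω : K}
    (hω : ω ^ 2 + ω + 1 = 0) (P : Submodule K V → Prop) (k : ℕ)
    (hk : ∀ a b ℓ, GoodPair a b → ℓ ≤ eig T a → finrank K ℓ = 2 →
      {π | IsFrame T a b ℓ π ∧ P π}.ncard = k) :
    {π | IsHPlane T π ∧ P π}.ncard
      = {p : K × K | GoodPair p.1 p.2}.ncard * (Nat.card K ^ 2 + Nat.card K + 1) * k := by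
  rw [← ncard_frameIndex hT]
  refine ncard_eq_mul_of_fibers (fun π p => IsFrame T p.1.1 p.1.2 p.2 π) k ?_ ?_
  · rintro π ⟨hπ, -⟩
    obtain ⟨a, b, ℓ, h, hF⟩ := hπ.exists_isFrame hT hω
    refine ⟨((a, b), ℓ), ⟨⟨h, hF.finrank_line, hF.le_eig⟩, hF⟩, ?_⟩
    rintro ⟨⟨a', b'⟩, ℓ'⟩ ⟨-, hF'⟩
    obtain ⟨h1, h2, h3⟩ := hF'.unique hF
    simp only at h1 h2 h3
    rw [h1, h2, h3]
  · rintro ⟨⟨a, b⟩, ℓ⟩ ⟨h, hd, hle⟩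
    rw [← hk a b ℓ h hle hd]
    congr 1
    ext π
    exact ⟨fun hp => ⟨hp.2, hp.1.2⟩, fun hp => ⟨⟨hp.1.isHPlane hT h, hp.2⟩, hp.1⟩⟩

end

/-! ### Dimension of the eigenspaces via Hilbert 90 -/

section

variable {K L V : Type*} [Field K] [Field L] [Algebra K L] [AddCommGroup V] [Module K V]
  [Module L V]

theorem companion_cube {T : SemilinearAut K L V} (hV : finrank L V = 3)
    (hcube : ∀ v, T.toEquiv (T.toEquiv (T.toEquiv v)) = v) (x : L) :
    T.companion (T.companion (T.companion x)) = x := by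
  have : Nontrivial V := nontrivial_of_finrank_pos (R := L) (by omega)
  obtain ⟨v, hv⟩ := exists_ne (0 : V)
  have h := hcube (x • v)
  simp only [T.map_smul, hcube] at h
  exact smul_left_injective L hv h

/-- The vectors of a pointwise fixed subplane share their eigenvalue. -/
theorem exists_eigenvalue {T : SemilinearAut K L V} (e : Basis (Fin 3) L V)
    (hfix : ∀ v ∈ Submodule.span K (Set.range e), v ≠ 0 →
      phi T (Submodule.span L {v}) = Submodule.span L {v}) :
    ∃ μ : L, μ ≠ 0 ∧ ∀ i, T.toEquiv (e i) = μ • e i := by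
  have hmem : ∀ i, e i ∈ Submodule.span K (Set.range e) := fun i => Submodule.subset_span ⟨i, rfl⟩
  have h1 : ∀ i, ∃ μ : L, T.toEquiv (e i) = μ • e i := fun i =>
    (phi_span_eq_iff (e.ne_zero i)).1 (hfix _ (hmem i) (e.ne_zero i))
  choose μ hμ using h1
  have hs : e 0 + e 1 + e 2 ≠ 0 := by
    intro h
    have h2 := congrArg (fun v => e.repr v 0) h
    simp at h2
  obtain ⟨ν, hν⟩ := (phi_span_eq_iff hs).1 (hfix _ (add_mem (add_mem (hmem 0) (hmem 1)) (hmem 2)) hs)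
  simp only [map_add, hμ, smul_add] at hν
  have h3 : ∀ i, μ i = ν := by
    intro i
    have h4 := congrArg (fun v => e.repr v i) hν
    fin_cases i <;> simpa [Finsupp.single_apply] using h4
  refine ⟨ν, ?_, fun i => by rw [hμ, h3]⟩
  rintro rfl
  have h5 := hμ 0
  rw [h3, zero_smul] at h5
  exact IsRegular.map_ne_zero (e.ne_zero 0) h5

theorem companion_ne_refl {T : SemilinearAut K L V} (hphi : PhiOrderThree T)
    (e : Basis (Fin 3) L V) {μ : L} (he : ∀ i, T.toEquiv (e i) = μ • e i) :
    T.companion ≠ AlgEquiv.refl := by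
  intro h
  have hT : ∀ v, T.toEquiv v = μ • v := by
    intro v
    rw [← e.sum_repr v, map_sum, Finset.smul_sum]
    refine Finset.sum_congr rfl fun i _ => ?_
    rw [T.map_smul, h, he, AlgEquiv.coe_refl, id, smul_comm]
  obtain ⟨-, P, hP, hne⟩ := hphi
  obtain ⟨v, h0, rfl⟩ := finrank_eq_one_iff_exists_span.1 hP
  exact hne ((phi_span_eq_iff h0).2 ⟨μ, hT v⟩)

/-- The degree is prime, so the fixed field of a nontrivial automorphism has no room to exceed `K`.
-/
theorem exists_of_companion_fixed {θ : L ≃ₐ[K] L} (hL : finrank K L = 3)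
    (hθ : θ ≠ AlgEquiv.refl) {x : L} (hx : θ x = x) : ∃ k : K, algebraMap K L k = x := by
  have hs := IntermediateField.isSimpleOrder_of_finrank_prime K L (by rw [hL]; norm_num)
  rcases hs.eq_bot_or_eq_top (IntermediateField.fixedField (Subgroup.zpowers θ)) with h | h
  · have : x ∈ IntermediateField.fixedField (Subgroup.zpowers θ) := by
      rw [IntermediateField.mem_fixedField_iff]
      intro f hf
      have hst : Subgroup.zpowers θ ≤ MulAction.stabilizer (L ≃ₐ[K] L) x := by
        rw [Subgroup.zpowers_le]
        exact hx
      exact hst hf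
    rw [h, IntermediateField.mem_bot] at this
    exact this
  · exfalso
    apply hθ
    ext y
    have : y ∈ IntermediateField.fixedField (Subgroup.zpowers θ) := by rw [h]; trivial
    exact (IntermediateField.mem_fixedField_iff _ _).1 this θ (Subgroup.mem_zpowers θ)

/-- Hilbert's Theorem 90 for an automorphism of order three. -/
theorem exists_companion_eq_mul {θ : L ≃ₐ[K] L} (hθ : θ ≠ AlgEquiv.refl)
    (h3 : ∀ x, θ (θ (θ x)) = x) {c : L} (hc : c * θ c * θ (θ c) = 1) :
    ∃ s : L, s ≠ 0 ∧ θ s = c * s := by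
  have hc0 : c ≠ 0 := by
    rintro rfl
    simp at hc
  have hθc : θ c ≠ 0 := by simpa using hc0
  have hne1 : (θ : L →* L) ≠ MonoidHom.id L := fun h => hθ (by
    ext x; exact DFunLike.congr_fun h x)
  have hne2 : ((θ : L →* L).comp (θ : L →* L)) ≠ MonoidHom.id L := fun h => hθ (by
    ext x
    have h1 : θ (θ (θ x)) = θ x := DFunLike.congr_fun h (θ x)
    rw [h3] at h1
    exact h1.symm)
  have hne3 : ((θ : L →* L).comp (θ : L →* L)) ≠ (θ : L →* L) := fun h => hθ (by
    ext x
    have h1 : θ (θ x) = θ x := DFunLike.congr_fun h x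
    exact θ.injective h1)
  have hli := (linearIndependent_monoidHom L L).comp
    ![MonoidHom.id L, (θ : L →* L), (θ : L →* L).comp (θ : L →* L)] (by
      intro i j hij
      fin_cases i <;> fin_cases j <;> simp at hij ⊢
      · exact hne1 hij.symm
      · exact hne2 hij.symm
      · exact hne1 hij
      · exact hne3 hij.symm
      · exact hne2 hij
      · exact hne3 hij)
  -- This resolvent is multiplied by `c` under `θ`; Dedekind independence of `1, θ, θ²` makes it
  -- nonzero for some `y`.
  obtain ⟨y, hy⟩ : ∃ y : L, y + c⁻¹ * θ y + (c * θ c)⁻¹ * θ (θ y) ≠ 0 := by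
    by_contra! hcon
    have h1 := Fintype.linearIndependent_iff.1 hli ![1, c⁻¹, (c * θ c)⁻¹] (by
      ext y
      have := hcon y
      simpa [Fin.sum_univ_three] using this) 0
    simp at h1
  refine ⟨_, hy, ?_⟩
  have hc2 : θ (θ c) = (c * θ c)⁻¹ := eq_inv_of_mul_eq_one_right hc
  simp only [map_add, map_mul, map_inv₀, h3, hc2]
  field_simp
  ring

variable [IsScalarTower K L V]

theorem isRegular {T : SemilinearAut K L V} (hL : finrank K L = 3) (hV : finrank L V = 3)
    (hcube : ∀ v, T.toEquiv (T.toEquiv (T.toEquiv v)) = v) (hphi : PhiOrderThree T)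
    (hplane : ∃ B : Set (Submodule L V), IsSubplane K B ∧ ∀ P ∈ B, phi T P = P) :
    IsRegular T := by
  obtain ⟨B, ⟨e, rfl⟩, hB⟩ := hplane
  obtain ⟨μ, hμ, he⟩ := exists_eigenvalue (T := T) e (fun v hv h0 => hB _ ⟨v, hv, h0, rfl⟩)
  have hθ := companion_ne_refl hphi e he
  have h3 := companion_cube hV hcube
  have hN : μ * T.companion μ * T.companion (T.companion μ) = 1 := by
    have h := hcube (e 0)
    simp only [he, T.map_smul, smul_smul] at h
    apply smul_left_injective L (e.ne_zero 0)
    simp only [one_smul]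
    refine Eq.trans ?_ h
    congr 1
    rw [map_mul]
    ring
  refine ⟨hcube, h3, fun x hx => exists_of_companion_fixed hL hθ hx, hL, ?_, ?_⟩
  · rw [← Module.finrank_mul_finrank K L V, hL, hV]
  · intro a ha
    -- `T(s eᵢ) = θ(s)μ eᵢ` equals `a s eᵢ` when `θ(s) = aμ⁻¹s`. This is solvable because `aμ⁻¹` has
    -- norm `a³ / N(μ) = 1`, and the `s eᵢ` then form a basis of `eig T a`.
    obtain ⟨s, hs, hsθ⟩ := exists_companion_eq_mul hθ h3 (c := algebraMap K L a * μ⁻¹) (by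
      simp only [map_mul, map_inv₀, AlgEquiv.commutes]
      have : (algebraMap K L a) ^ 3 = 1 := by rw [← map_pow, ha, map_one]
      rw [show algebraMap K L a * μ⁻¹ * (algebraMap K L a * (T.companion μ)⁻¹)
        * (algebraMap K L a * (T.companion (T.companion μ))⁻¹)
        = (algebraMap K L a) ^ 3 * (μ * T.companion μ * T.companion (T.companion μ))⁻¹ by
          rw [mul_inv, mul_inv]; ring, this, hN]
      simp)
    have ha0 : a ≠ 0 := by rintro rfl; simp at ha
    have hsθ' : T.companion s * μ = algebraMap K L a * s := by
      rw [hsθ]; field_simp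
    have hli : LinearIndependent K (fun i => s • e i) := by
      have h1 : LinearIndependent K e := e.linearIndependent.restrict_scalars
        (by simpa [← Algebra.algebraMap_eq_smul_one] using (algebraMap K L).injective)
      exact h1.map' (DistribSMul.toLinearMap K V s) (LinearMap.ker_eq_bot.2
        (smul_right_injective V hs))
    have hspan : eig T a = Submodule.span K (Set.range fun i => s • e i) := by
      apply le_antisymm
      · intro v hv
        rw [mem_eig] at hv
        have hco : ∀ i, ∃ k : K, algebraMap K L k = e.repr v i / s := by
          intro i
          apply exists_of_companion_fixed hL hθ
          have h1 : T.toEquiv v = ∑ i, (T.companion (e.repr v i) * μ) • e i := by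
            conv_lhs => rw [← e.sum_repr v]
            rw [map_sum]
            refine Finset.sum_congr rfl fun i _ => ?_
            rw [T.map_smul, he, smul_smul]
          have h2 : T.companion (e.repr v i) * μ = algebraMap K L a * e.repr v i := by
            have h4 := congrArg (fun w => e.repr w i) (h1.symm.trans hv)
            simp only [e.repr_sum_self] at h4
            rw [h4, ← algebraMap_smul L a v, map_smul, Finsupp.smul_apply, smul_eq_mul]
          have hsθ0 : T.companion s ≠ 0 := by simpa using hs
          rw [map_div₀, div_eq_div_iff hsθ0 hs]
          apply mul_left_cancel₀ hμ
          linear_combination s * h2 - e.repr v i * hsθ'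
        choose k hk using hco
        rw [← e.sum_repr v]
        refine Submodule.sum_mem _ fun i _ => ?_
        have : e.repr v i • e i = k i • s • e i := by
          rw [← algebraMap_smul L (k i), hk, smul_smul, div_mul_cancel₀ _ hs]
        rw [this]
        exact Submodule.smul_mem _ _ (Submodule.subset_span ⟨i, rfl⟩)
      · rw [Submodule.span_le]
        rintro _ ⟨i, rfl⟩
        rw [SetLike.mem_coe, mem_eig, T.map_smul, he, smul_smul, hsθ', mul_smul, algebraMap_smul]
    rw [hspan, finrank_span_eq_card hli, Fintype.card_fin]

end

/-! ### Cube roots of unity in `K`, and the case `q ≡ -1 (mod 3)` -/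

section

theorem three_eq_zero_iff {K : Type*} [Field K] [Fintype K] :
    (3 : K) = 0 ↔ 3 ∣ Fintype.card K := by
  obtain ⟨p, hp⟩ := CharP.exists K
  obtain ⟨n, hpp, hn⟩ := FiniteField.card K p
  have h := CharP.cast_eq_zero_iff K p 3
  rw [show ((3 : ℕ) : K) = 3 by norm_num] at h
  rw [h, hn]
  constructor
  · intro h3
    rw [(Nat.prime_dvd_prime_iff_eq hpp Nat.prime_three).1 h3]
    exact dvd_pow_self 3 n.ne_zero
  · intro h3
    rw [(Nat.prime_dvd_prime_iff_eq Nat.prime_three hpp).1 (Nat.prime_three.dvd_of_dvd_pow h3)]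

theorem eq_one_of_cube {K : Type*} [Field K] [Fintype K] (h : Fintype.card K % 3 = 2) {c : K}
    (hc : c ^ 3 = 1) : c = 1 := by
  have hc0 : c ≠ 0 := by rintro rfl; simp at hc
  have h1 := FiniteField.pow_card_sub_one_eq_one c hc0
  have h2 := Nat.dvd_gcd (orderOf_dvd_of_pow_eq_one hc) (orderOf_dvd_of_pow_eq_one h1)
  have h3 : Nat.gcd 3 (Fintype.card K - 1) = 1 := by
    rw [← Nat.coprime_iff_gcd_eq_one, Nat.Prime.coprime_iff_not_dvd Nat.prime_three]
    omega
  rw [h3, Nat.dvd_one, orderOf_eq_one_iff] at h2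
  exact h2

theorem eq_one_of_cube_of_three {K : Type*} [Field K] (h : (3 : K) = 0) {c : K}
    (hc : c ^ 3 = 1) : c = 1 := by
  have : (c - 1) ^ 3 = 0 := by linear_combination hc - (c ^ 2 - c) * h
  exact sub_eq_zero.1 (pow_eq_zero_iff (by norm_num) |>.1 this)

theorem ncard_goodPair_of_three {K : Type*} [Field K] (h : (3 : K) = 0) :
    {p : K × K | GoodPair p.1 p.2}.ncard = 1 := by
  rw [Set.ncard_eq_one]
  refine ⟨(1, 1), ?_⟩
  ext ⟨a, b⟩
  simp only [Set.mem_ofPred_eq, Set.mem_singleton_iff, Prod.mk.injEq]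
  constructor
  · intro hg
    exact ⟨eq_one_of_cube_of_three h hg.1, eq_one_of_cube_of_three h hg.symm.1⟩
  · rintro ⟨rfl, rfl⟩
    exact ⟨one_pow 3, by linear_combination h⟩

theorem GoodPair.eps_eq {K : Type*} [Field K] {a b : K} (h : GoodPair a b) :
    ((3 : K) = 0 → eps a b = 0) ∧ ((3 : K) ≠ 0 → eps a b = 1) := by
  constructor
  · intro h3
    rw [eq_one_of_cube_of_three h3 h.1, eq_one_of_cube_of_three h3 h.symm.1]
    exact if_pos rfl
  · intro h3
    refine if_neg ?_
    rintro rfl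
    have h1 : (3 : K) * a ^ 2 = 0 := by linear_combination h.2
    rcases mul_eq_zero.1 h1 with h2 | h2
    · exact h3 h2
    · exact h.ne_zero (pow_eq_zero_iff (by norm_num) |>.1 h2)

theorem ncard_goodPair_of_omega {K : Type*} [Field K] [Finite K] {ω : K}
    (hω : ω ^ 2 + ω + 1 = 0) (h1 : (3 : K) ≠ 0) :
    {p : K × K | GoodPair p.1 p.2}.ncard = 6 := by
  have hω1 : ω ≠ 1 := by
    rintro rfl
    exact h1 (by linear_combination hω)
  have hω0 : ω ≠ 0 := by
    rintro rfl
    simp at hω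
  have hω2 : ω ≠ ω ^ 2 := fun h => hω1 (mul_left_cancel₀ hω0 (by linear_combination -h))
  have hω21 : ω ^ 2 ≠ 1 := by
    intro h
    have : ω = -2 := by linear_combination hω - h
    subst this
    exact h1 (by linear_combination h)
  have hcubes : {a : K | a ^ 3 = 1}.ncard = 3 := by
    have : {a : K | a ^ 3 = 1} = {1, ω, ω ^ 2} := by
      ext a
      simp only [Set.mem_ofPred_eq, Set.mem_insert_iff, Set.mem_singleton_iff]
      constructor
      · intro ha
        have h2 : (a - 1) * ((a - ω) * (a - ω ^ 2)) = 0 := by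
          linear_combination ha + (-a ^ 2 + a + (a - 1) * (ω - 1)) * hω
        rcases mul_eq_zero.1 h2 with h3 | h3
        · exact Or.inl (sub_eq_zero.1 h3)
        rcases mul_eq_zero.1 h3 with h4 | h4
        · exact Or.inr (Or.inl (sub_eq_zero.1 h4))
        · exact Or.inr (Or.inr (sub_eq_zero.1 h4))
      · rintro (rfl | rfl | rfl)
        · exact one_pow 3
        · linear_combination (a - 1) * hω
        · linear_combination (ω - 1) * (ω ^ 3 + 1) * hω
    rw [this, Set.ncard_eq_three]
    exact ⟨1, ω, ω ^ 2, hω1.symm, hω21.symm, hω2, rfl⟩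
  rw [show 6 = 3 * 2 by norm_num, ← hcubes]
  refine ncard_eq_mul_of_fibers (fun p a => p.1 = a) 2 ?_ ?_
  · rintro p hp
    exact ⟨p.1, ⟨hp.1, rfl⟩, fun a ha => ha.2.symm⟩
  · rintro a ha
    have ha0 : a ≠ 0 := by rintro rfl; simp at ha
    have : {p : K × K | p ∈ {p : K × K | GoodPair p.1 p.2} ∧ p.1 = a}
        = {(a, a * ω), (a, a * ω ^ 2)} := by
      ext ⟨x, b⟩
      simp only [Set.mem_ofPred_eq, Set.mem_insert_iff, Set.mem_singleton_iff, Prod.mk.injEq]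
      constructor
      · rintro ⟨hg, rfl⟩
        have h2 : (b - x * ω) * (b - x * ω ^ 2) = 0 := by
          linear_combination hg.2 + (-b * x + x ^ 2 * (ω - 1)) * hω
        rcases mul_eq_zero.1 h2 with h4 | h4
        · exact Or.inl ⟨rfl, sub_eq_zero.1 h4⟩
        · exact Or.inr ⟨rfl, sub_eq_zero.1 h4⟩
      · rintro (⟨rfl, rfl⟩ | ⟨rfl, rfl⟩)
        · exact ⟨⟨ha, by linear_combination x ^ 2 * hω⟩, rfl⟩
        · exact ⟨⟨ha, by linear_combination x ^ 2 * (ω ^ 2 - ω + 1) * hω⟩, rfl⟩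
    rw [this, Set.ncard_pair]
    intro h
    exact hω2 (mul_left_cancel₀ ha0 (Prod.mk.inj h).2)

theorem exists_omega {K : Type*} [Field K] [Fintype K] (h : Fintype.card K % 3 = 1) :
    ∃ ω : K, ω ^ 2 + ω + 1 = 0 := by
  classical
  have : Fact (Nat.Prime 3) := ⟨Nat.prime_three⟩
  obtain ⟨u, hu⟩ := exists_prime_orderOf_dvd_card (G := Kˣ) 3 (by
    rw [Fintype.card_units]; omega)
  have h3 : (u : K) ^ 3 = 1 := by
    rw [← Units.val_pow_eq_pow_val, ← hu, pow_orderOf_eq_one, Units.val_one]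
  have h1 : (u : K) - 1 ≠ 0 := by
    intro hc
    have : u = 1 := Units.ext (sub_eq_zero.1 hc)
    rw [this, orderOf_one] at hu
    omega
  exact ⟨u, mul_left_cancel₀ h1 (by linear_combination h3)⟩

variable {K L V : Type*} [Field K] [Field L] [Algebra K L] [AddCommGroup V] [Module K V]
  [Module L V]

/-- Only `c = 1` is available, so `T² + T + 1` kills the plane and a fixed vector `v` satisfies `3v
= 0`. Thus `0` is the only fixed vector, and orbits under `T` give `q³ ≡ 1 (mod 3)`, whereas `q³ ≡
2`. -/
theorem not_isHPlane [Fintype K] [Finite V] {T : SemilinearAut K L V} (hT : IsRegular T)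
    (h : Fintype.card K % 3 = 2) (π : Submodule K V) : ¬ IsHPlane T π := by
  classical
  intro hπ
  obtain ⟨c, hc, hq⟩ := hπ.exists_quadratic hT
  have hc1 := eq_one_of_cube h hc
  subst hc1
  have h3 : (3 : K) ≠ 0 := by
    rw [Ne, three_eq_zero_iff]
    omega
  have hinv := (sigma_eq_iff T π).1 hπ.2.1
  let f : Function.End π := fun v => ⟨T.toEquiv v, hinv v v.2⟩
  have hf : f ^ 3 ^ 1 = 1 := by
    funext v
    exact Subtype.ext (hT.cube v)
  have : Fintype π := Fintype.ofFinite π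
  have : Fact (Nat.Prime 3) := ⟨Nat.prime_three⟩
  have hmod := Equiv.Perm.card_fixedPoints_modEq hf
  have hfix : Fintype.card (Function.fixedPoints f) = 1 := by
    rw [Fintype.card_eq_one_iff]
    refine ⟨⟨0, Subtype.ext (map_zero T.toEquiv)⟩, ?_⟩
    rintro ⟨⟨v, hv⟩, hfv⟩
    have h1 : T.toEquiv v = v := congrArg Subtype.val hfv
    have h2 := hq v hv
    rw [h1, h1] at h2
    have h4 : (3 : K) • v = 0 := by
      linear_combination (norm := module) h2
    have h5 : v = 0 := by simpa [h3] using h4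
    exact Subtype.ext (Subtype.ext h5)
  rw [hfix, ← Nat.card_eq_fintype_card, natCard_submodule, hπ.1, Nat.card_eq_fintype_card] at hmod
  have h5 : Fintype.card K ^ 3 % 3 = 2 := by
    rw [Nat.pow_mod, h]
  rw [Nat.ModEq, h5] at hmod
  norm_num at hmod

end

end Bose

/-! ### The theorem -/

theorem theorem22 {K L V : Type*} [Field K] [Fintype K] [Field L] [Algebra K L]
    [AddCommGroup V] [Module K V] [Module L V] [IsScalarTower K L V]
    (hL : Module.finrank K L = 3) (hV : Module.finrank L V = 3)
    (q : ℕ) (hq : q = Fintype.card K) (hq2 : 2 < q)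
    (n : ℤ) (hn : n = -1 ∨ n = 0 ∨ n = 1) (hqn : (q : ℤ) ≡ n [ZMOD 3])
    (g : ℕ) (hg : g = Nat.gcd 3 (q - 1))
    (T : Bose.SemilinearAut K L V)
    (hcube : ∀ v : V, T.toEquiv (T.toEquiv (T.toEquiv v)) = v)
    (hphi : Bose.PhiOrderThree T)
    (hplane : ∃ B : Set (Submodule L V), Bose.IsSubplane K B ∧ ∀ P ∈ B, Bose.phi T P = P) :
    ((q : ℤ) ≡ -1 [ZMOD 3] → ¬ ∃ π, Bose.IsHPlane T π) ∧
    (¬ (q : ℤ) ≡ -1 [ZMOD 3] →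
      (∀ π, Bose.IsHPlane T π → Xor (Bose.IsH1Plane T π) (Bose.IsH2Plane T π)) ∧
      (∃ π, Bose.IsH1Plane T π) ∧ (∃ π, Bose.IsH2Plane T π) ∧
      (∀ π, Bose.IsH1Plane T π →
        (∃ S, Bose.IsHI5Space T S ∧ π ≤ S) ∧
        (({A | Bose.IsFixedPoint T A ∧ A ≤ π}.ncard : ℕ) : ℤ) = q + 1 + n ∧
        (({A | Bose.IsIColPoint T A ∧ A ≤ π}.ncard : ℕ) : ℤ) = q - n ∧
        (({A | Bose.IsIIColPoint T A ∧ A ≤ π}.ncard : ℕ) : ℤ) = (q : ℤ) ^ 2 - q ∧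
        {l | Bose.IsPtwiseFixedLine T l ∧ l ≤ π}.ncard = 1 ∧
        {l | Bose.IsFixedILine T l ∧ l ≤ π}.ncard = 1 ∧
        (({l | Bose.IsFixedIILine T l ∧ l ≤ π}.ncard : ℕ) : ℤ) = q - 1 + n) ∧
      (({π | Bose.IsH1Plane T π}.ncard : ℕ) : ℤ)
        = g * (n + 1) * (q + 1) * ((q : ℤ) ^ 2 + q + 1) ∧
      (∀ π, Bose.IsH2Plane T π →
        (({A | Bose.IsFixedPoint T A ∧ A ≤ π}.ncard : ℕ) : ℤ) = q + 1 + n ∧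
        (({A | Bose.IsIIColPoint T A ∧ A ≤ π}.ncard : ℕ) : ℤ) = (q : ℤ) ^ 2 - n ∧
        {l | Bose.IsPtwiseFixedLine T l ∧ l ≤ π}.ncard = 1 ∧
        (({l | Bose.IsFixedIILine T l ∧ l ≤ π}.ncard : ℕ) : ℤ) = q + n) ∧
      (({π | Bose.IsH2Plane T π}.ncard : ℕ) : ℤ)
        = g * (n + 1) * ((q : ℤ) ^ 2 + n - 1) * ((q : ℤ) ^ 2 + q + 1)) := by
  have hT := Bose.isRegular hL hV hcube hphi hplane
  have : FiniteDimensional K V :=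
    FiniteDimensional.of_finrank_pos (by rw [hT.finrank_space]; norm_num)
  have : Finite V := Module.finite_of_finite K
  refine ⟨?_, ?_⟩
  · rintro h ⟨π, hπ⟩
    refine Bose.not_isHPlane hT ?_ π hπ
    rw [Int.ModEq] at h
    omega
  intro hne
  -- The two remaining congruence classes are treated together: `n` is the common value of `eps`,
  -- and the number of good pairs is `1 = 1 · 1` or `6 = 3 · 2`.
  obtain ⟨ω, hω, N, rfl, heps, hG⟩ : ∃ ω : K, ω ^ 2 + ω + 1 = 0 ∧ ∃ N : ℕ, n = N ∧
      (∀ a b : K, Bose.GoodPair a b → Bose.eps a b = N) ∧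
      {p : K × K | Bose.GoodPair p.1 p.2}.ncard = g * (N + 1) := by
    rcases hn with rfl | rfl | rfl
    · exact absurd hqn hne
    · have h3 : Fintype.card K % 3 = 0 := by rw [Int.ModEq] at hqn; omega
      have h0 : (3 : K) = 0 := Bose.three_eq_zero_iff.2 (Nat.dvd_of_mod_eq_zero h3)
      refine ⟨1, by linear_combination h0, 0, rfl, fun a b h => h.eps_eq.1 h0, ?_⟩
      have : Nat.gcd 3 (q - 1) = 1 := by
        rw [← Nat.coprime_iff_gcd_eq_one, Nat.Prime.coprime_iff_not_dvd Nat.prime_three]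
        omega
      rw [Bose.ncard_goodPair_of_three h0, hg, this]
    · have h3 : Fintype.card K % 3 = 1 := by rw [Int.ModEq] at hqn; omega
      have h0 : (3 : K) ≠ 0 := by rw [Ne, Bose.three_eq_zero_iff]; omega
      obtain ⟨ω, hω⟩ := Bose.exists_omega h3
      refine ⟨ω, hω, 1, rfl, fun a b h => h.eps_eq.2 h0, ?_⟩
      have : Nat.gcd 3 (q - 1) = 3 := Nat.gcd_eq_left (by omega)
      rw [Bose.ncard_goodPair_of_omega hω h0, hg, this]
  have hcard : Nat.card K = q := by rw [Nat.card_eq_fintype_card, hq]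
  have hg0 : 0 < g := hg ▸ Nat.gcd_pos_of_pos_left _ (by norm_num)
  have hN : N ≤ 1 := by omega
  have hH1 : {π | Bose.IsH1Plane T π}.ncard = g * (N + 1) * (q ^ 2 + q + 1) * (q + 1) := by
    rw [← hG, ← hcard]
    exact Bose.ncard_hPlanes_sep hT hω _ _ fun a b ℓ h hle hd =>
      Bose.ncard_frames_fixedILine hT h hle hd
  have hH2 : {π | Bose.IsH2Plane T π}.ncard = g * (N + 1) * (q ^ 2 + q + 1) * (q ^ 2 + N - 1) := by
    rw [← hG, ← hcard]
    refine Bose.ncard_hPlanes_sep hT hω _ _ fun a b ℓ h hle hd => ?_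
    have := Bose.ncard_frames_not_fixedILine hT h hle hd
    rw [heps a b h] at this
    omega
  -- Needed to cast the truncated difference `q ^ 2 + N - 1` to the integers.
  have hq1 : 1 ≤ q ^ 2 + N := le_add_right (Nat.one_le_pow _ _ (by omega))
  have hq4 : 4 ≤ q ^ 2 := by nlinarith
  refine ⟨?_, ?_, ?_, ?_, ?_, ?_, ?_⟩
  · intro π hπ
    by_cases h : ∃ l ≤ π, Bose.IsFixedILine T l
    · exact Or.inl ⟨⟨hπ, h⟩, fun h2 => h2.2 h⟩
    · exact Or.inr ⟨⟨hπ, h⟩, fun h1 => h h1.2⟩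
  · refine Set.nonempty_of_ncard_ne_zero (s := {π | Bose.IsH1Plane T π}) ?_
    rw [hH1]
    positivity
  · refine Set.nonempty_of_ncard_ne_zero (s := {π | Bose.IsH2Plane T π}) ?_
    rw [hH2]
    have : 0 < q ^ 2 + N - 1 := by omega
    positivity
  · rintro π ⟨hπ, hI⟩
    obtain ⟨a, b, ℓ, h, hF⟩ := hπ.exists_isFrame hT hω
    have e1 := hF.ncard_fixed
    have e2 := hF.ncard_of_fixedILine hT h hI
    have e3 := hF.ncard_IIColPoint hT
    have e4 := hF.ncard_nonfixed
    have e5 := hF.ncard_fixedIILine hT h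
    rw [hF.ncard_fixedLines] at e5
    rw [heps a b h, hcard] at e1 e2 e4 e5
    refine ⟨hF.exists_HI5Space hT h hI, ?_, ?_, ?_, hF.ncard_ptwiseFixedLine, e2.2, ?_⟩
    · rw [e1]; push_cast; rfl
    · omega
    · zify at e2 e3 e4
      linarith [e2.1]
    · omega
  · rw [hH1]; push_cast; ring
  · rintro π ⟨hπ, hI⟩
    obtain ⟨a, b, ℓ, h, hF⟩ := hπ.exists_isFrame hT hω
    have e1 := hF.ncard_fixed
    have e2 := hF.ncard_of_not_fixedILine hI
    have e3 := hF.ncard_IIColPoint hT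
    have e4 := hF.ncard_nonfixed
    have e5 := hF.ncard_fixedIILine hT h
    rw [hF.ncard_fixedLines] at e5
    rw [heps a b h, hcard] at e1 e4 e5
    refine ⟨?_, ?_, hF.ncard_ptwiseFixedLine, ?_⟩
    · rw [e1]; push_cast; rfl
    · zify at e2 e3 e4
      linarith [e2.1]
    · omega
  · have : ((q ^ 2 + N - 1 : ℕ) : ℤ) = (q : ℤ) ^ 2 + N - 1 := by
      rw [Nat.cast_sub hq1]; push_cast; ring
    rw [hH2, Nat.cast_mul, this]; push_cast; ring
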